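/- Let $M=(S,\mathcal B)$ be a matroid of rank $r$ on a finite ground set $S$, with rank function $r_M$. For $x\in\mathbb R^S$ and $F\subseteq S$ write $x(F)=\sum_{e\in F}x_e$ and $H_F=\{x\in\mathbb R^S: x(F)=r_M(F)\}$. Let $P(M)\subseteq\mathbb R^S$ be the base polytope of $M$, that is, the convex hull of the indicator vectors of the bases, and let $Q(M)$ be the intersection of the affine span of $P(M)$ with the hypersimplex $\Delta(r,S)=\{x\in[0,1]^S: x(S)=r\}$. Call $F\subseteq S$ a *split facet set* if $P(M)\cap H_F$ is a facet of $P(M)$ and $H_F$ meets the relative interior of $Q(M)$. The matroid $M$ is a *split matroid* if for any two split facet sets $F,G$ with $P(M)\cap H_F\neq P(M)\cap H_G$, the hyperplanes $H_F$ and $H_G$ do not meet in the relative interior of $Q(M)$. Suppose that $M$ is a split matroid and that $S$ can be partitioned into two bases of $M$. Then $M$ is equitable: for every $X\subseteq S$ there is a basis $B$ of $M$ such that $S-B$ is also a basis and $$\left\lfloor \frac{|X|}{2}\right\rfloor\le |B\cap X|\le\left\lceil\frac{|X|}{2}\right\rceil .$$ -/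

import Mathlib

noncomputable section

namespace Matroid

variable {α : Type*}

/-- The rank of a set `F` in `M`, as a natural number. -/
def rkNat (M : Matroid α) (F : Set α) : ℕ := (M.eRk F).toNat

/-- The base polytope of `M`: the convex hull of the 0/1 indicator vectors of the bases of `M`. -/
def basePolytope (M : Matroid α) : Set (α → ℝ) :=
  convexHull ℝ {x | ∃ B, M.IsBase B ∧ x = B.indicator 1}

/-- The hypersimplex on the ground set of `M`, of the same rank as `M`, that is, the base polytope
of the uniform matroid with the ground set and the rank of `M`. -/
def hypersimplex (M : Matroid α) : Set (α → ℝ) :=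
  {x | (∀ e ∈ M.E, 0 ≤ x e ∧ x e ≤ 1) ∧ (∀ e ∉ M.E, x e = 0) ∧
    ∑ᶠ e ∈ M.E, x e = (M.rkNat M.E : ℝ)}

/-- The hypersimplex intersected with the affine span of the base polytope. This is the whole
hypersimplex if `M` is connected. -/
def ambientPolytope (M : Matroid α) : Set (α → ℝ) :=
  (affineSpan ℝ M.basePolytope : Set (α → ℝ)) ∩ M.hypersimplex

/-- The hyperplane `x(F) = r(F)`; the inequality `x(F) ≤ r(F)` is valid on the base polytope. -/
def rankHyperplane (M : Matroid α) (F : Set α) : Set (α → ℝ) :=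
  {x | ∑ᶠ e ∈ F, x e = (M.rkNat F : ℝ)}

/-- `F` defines a facet of the base polytope: the face in which the inequality `x(F) ≤ r(F)` is
tight is non-empty and has codimension one in the base polytope. -/
def IsFacetDefining (M : Matroid α) (F : Set α) : Prop :=
  F ⊆ M.E ∧ (M.basePolytope ∩ M.rankHyperplane F).Nonempty ∧
    Module.finrank ℝ (vectorSpan ℝ (M.basePolytope ∩ M.rankHyperplane F)) + 1 =
      Module.finrank ℝ (vectorSpan ℝ M.basePolytope)

/-- `F` defines a facet of the base polytope whose hyperplane cuts through the relative interior of
the ambient polytope. All edges of the ambient polytope are in directions `e_i - e_j`, so the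
integral hyperplane `x(F) = r(F)` cuts no edge in an inner point: it then splits the ambient
polytope into two pieces without new vertices. -/
def IsSplitFacet (M : Matroid α) (F : Set α) : Prop :=
  M.IsFacetDefining F ∧
    (M.rankHyperplane F ∩ intrinsicInterior ℝ M.ambientPolytope).Nonempty

/-- Split matroids (Joswig and Schröter): the splits defined by any two distinct facets of the base
polytope are compatible, that is, their hyperplanes do not meet in the relative interior of the
ambient polytope. (Different sets may define the same facet when `M` is disconnected.) -/
def IsSplit (M : Matroid α) : Prop :=
  ∀ F G : Set α, M.IsSplitFacet F → M.IsSplitFacet G →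
    M.basePolytope ∩ M.rankHyperplane F ≠ M.basePolytope ∩ M.rankHyperplane G →
    M.rankHyperplane F ∩ M.rankHyperplane G ∩ intrinsicInterior ℝ M.ambientPolytope = ∅

/-- Equitable matroids. The bounds are `⌊|X|/2⌋` and `⌈|X|/2⌉`. -/
def IsEquitable (M : Matroid α) : Prop :=
  ∀ X ⊆ M.E, ∃ B, M.IsBase B ∧ M.IsBase (M.E \ B) ∧
    X.ncard / 2 ≤ (B ∩ X).ncard ∧ (B ∩ X).ncard ≤ (X.ncard + 1) / 2

end Matroid

end

/-! Let K be a union of connected components. Both bases of the given partition span K, so |K| =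
2r(K). A subset B of K is encoded by a vector v that is 1 on B and -1 on K \ B. Then |B ∩ F| ≤ r(F)
reads v(F) ≤ s(F) with s(F) = 2r(F) - |F|, and the same condition for K \ B reads -v(F) ≤ s(F). For
connected K, a set of size r(K) is independent as soon as it satisfies these conditions for all
flacets F (`exists_isFlacet`). So if X and K \ X are even, it suffices to find v with v(X) = v(K \
X) = 0 and |v(F)| ≤ s(F) for every flacet F.

The split property says that different flacets F, G satisfy |F ∩ G| + r(K) ≤ r(F) + r(G)
(`IsSplit.ncard_inter_add_rkNat_le`): otherwise masses can be put on the four atoms of F and G so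
that a point interior to the ambient polytope lies on both hyperplanes. This uses that flacets
define facets, and different flacets different ones (`IsFlacet.isFacetDefining`,
`IsFlacet.eq_of_face_eq`). In terms of slacks, |F ∩ G| + |K \ (F ∪ G)| ≤ s(F) + s(G), whence |v(F) +
v(G)| ≤ s(F) + s(G) for balanced v: two sets are never violated in the same direction.

The rest is combinatorial (`IsSlackFamily.exists_balanced`). Take a violable F of least slack and
make it tight by exchanges. Any other violated set J is then violated from below, and further
exchanges that do not change v(F) raise v(J) until it is repaired, without a new violation. Odd X
gain one element, and separate components are glued by swapping B with its complement in one of them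
(`IsEquitableOn.union`). -/

/-! ### Balanced sign vectors -/

namespace SignVector

variable {α : Type*}

/-- A vector with entries `1` and `-1`. -/
def IsSign (v : α → ℤ) : Prop := ∀ e, v e = 1 ∨ v e = -1

lemma IsSign.neg {v : α → ℤ} (hv : IsSign v) : IsSign (-v) := by
  intro e
  rcases hv e with h | h <;> simp [h]

lemma IsSign.two_dvd_sum_sub_card {v : α → ℤ} (hv : IsSign v) (A : Finset α) :
    (2 : ℤ) ∣ ∑ e ∈ A, v e - A.card := by
  have h : ∑ e ∈ A, v e - A.card = ∑ e ∈ A, (v e - 1) := by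
    simp
  rw [h]
  refine Finset.dvd_sum fun e _ => ?_
  rcases hv e with h | h <;> simp [h]

lemma IsSign.sum_le_card {v : α → ℤ} (hv : IsSign v) (A : Finset α) :
    ∑ e ∈ A, v e ≤ A.card := by
  have := Finset.sum_le_card_nsmul A v 1 (fun e _ => by rcases hv e with h | h <;> simp [h])
  simpa using this

lemma IsSign.exists_eq_one {v : α → ℤ} (hv : IsSign v) {A : Finset α} (h : 0 < ∑ e ∈ A, v e) :
    ∃ p ∈ A, v p = 1 := by
  by_contra! hc
  refine absurd h (not_lt.2 (Finset.sum_nonpos fun e he => ?_))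
  rcases hv e with h | h
  · exact absurd h (hc e he)
  · omega

lemma IsSign.exists_eq_neg_one {v : α → ℤ} (hv : IsSign v) {A : Finset α}
    (h : ∑ e ∈ A, v e < 0) : ∃ p ∈ A, v p = -1 := by
  obtain ⟨p, hp, hvp⟩ := hv.neg.exists_eq_one (A := A) (by simpa using h)
  exact ⟨p, hp, by simp at hvp; omega⟩

variable [DecidableEq α]

/-- The vector `v` with `p` made negative and `q` made positive. -/
def flip (v : α → ℤ) (p q : α) : α → ℤ :=
  fun e => if e = p then -1 else if e = q then 1 else v e

lemma IsSign.flip {v : α → ℤ} (hv : IsSign v) (p q : α) : IsSign (flip v p q) := by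
  intro e
  unfold SignVector.flip
  split_ifs
  · right; rfl
  · left; rfl
  · exact hv e

lemma sum_flip {v : α → ℤ} {p q : α} (hp : v p = 1) (hq : v q = -1) (A : Finset α) :
    ∑ e ∈ A, flip v p q e
      = ∑ e ∈ A, v e + (if q ∈ A then 2 else 0) - (if p ∈ A then 2 else 0) := by
  have hpq : p ≠ q := by
    rintro rfl
    omega
  have h : ∀ e, flip v p q e = v e + (if e = q then 2 else 0) - (if e = p then 2 else 0) := by
    intro e
    unfold flip
    by_cases h1 : e = p
    · subst h1; simp [hp, hpq]
    · by_cases h2 : e = q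
      · subst h2; simp [hq, h1]
      · simp [h1, h2]
  simp only [h, Finset.sum_sub_distrib, Finset.sum_add_distrib, Finset.sum_ite_eq']

lemma sum_flip_of_iff {v : α → ℤ} {p q : α} (hp : v p = 1) (hq : v q = -1) {A : Finset α}
    (h : p ∈ A ↔ q ∈ A) : ∑ e ∈ A, flip v p q e = ∑ e ∈ A, v e := by
  rw [sum_flip hp hq, if_congr h rfl rfl]
  ring

lemma sum_inter_add_sum_sdiff (v : α → ℤ) (A F : Finset α) :
    ∑ e ∈ A ∩ F, v e + ∑ e ∈ A \ F, v e = ∑ e ∈ A, v e := by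
  rw [← Finset.sum_union (Finset.disjoint_left.2 fun e he he' =>
    (Finset.mem_sdiff.1 he').2 (Finset.mem_inter.1 he).2)]
  congr 1
  ext e
  simp only [Finset.mem_union, Finset.mem_inter, Finset.mem_sdiff]
  tauto

lemma sum_inter_add_sum_sdiff_inter (v : α → ℤ) {K F : Finset α} (X : Finset α) (hF : F ⊆ K) :
    ∑ e ∈ X ∩ F, v e + ∑ e ∈ (K \ X) ∩ F, v e = ∑ e ∈ F, v e := by
  rw [← sum_inter_add_sum_sdiff v F X, Finset.inter_comm F X]
  congr 2
  ext e
  have := @hF e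
  simp only [Finset.mem_inter, Finset.mem_sdiff]; tauto

/-- If no exchange inside `A` increases the sum over `H`, then that sum is large. -/
lemma IsSign.sum_inter_nonneg_or_le {v : α → ℤ} (hv : IsSign v) (A H : Finset α)
    (h : ∀ p ∈ A \ H, ∀ q ∈ A ∩ H, v p = 1 → v q ≠ -1) :
    0 ≤ ∑ e ∈ A ∩ H, v e ∨ ∑ e ∈ A, v e ≤ ∑ e ∈ A ∩ H, v e := by
  by_contra! hc
  have h1 := sum_inter_add_sum_sdiff v A H
  obtain ⟨q, hq, hvq⟩ := hv.exists_eq_neg_one hc.1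
  obtain ⟨p, hp, hvp⟩ := hv.exists_eq_one (A := A \ H) (by omega)
  exact h p hp q hq hvp hvq

/-- A sign vector with zero sum on `X` and on `K \ X`. -/
structure IsBalanced (K X : Finset α) (v : α → ℤ) : Prop where
  isSign : IsSign v
  sum_left : ∑ e ∈ X, v e = 0
  sum_right : ∑ e ∈ K \ X, v e = 0

namespace IsBalanced

variable {K X : Finset α} {v : α → ℤ}

lemma neg (hv : IsBalanced K X v) : IsBalanced K X (-v) :=
  ⟨hv.isSign.neg, by simp [hv.sum_left], by simp [hv.sum_right]⟩

lemma flip (hv : IsBalanced K X v) {p q : α} (hp : v p = 1) (hq : v q = -1)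
    (hpK : p ∈ K) (hqK : q ∈ K) (h : p ∈ X ↔ q ∈ X) : IsBalanced K X (flip v p q) := by
  refine ⟨hv.isSign.flip p q, ?_, ?_⟩
  · rw [sum_flip_of_iff hp hq h, hv.sum_left]
  · rw [sum_flip_of_iff hp hq (by simp [hpK, hqK, h]), hv.sum_right]

lemma sum_ground (hv : IsBalanced K X v) (hX : X ⊆ K) : ∑ e ∈ K, v e = 0 := by
  rw [← sum_inter_add_sum_sdiff v K X, Finset.inter_eq_right.2 hX, hv.sum_left, hv.sum_right,
    add_zero]

lemma exists_of_even (h1 : Even X.card) (h2 : Even (K \ X).card) :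
    ∃ v, IsBalanced K X v := by
  obtain ⟨a, ha⟩ := h1
  obtain ⟨b, hb⟩ := h2
  obtain ⟨A, hA, hAa⟩ := Finset.exists_subset_card_eq (s := X) (n := a) (by omega)
  obtain ⟨B, hB, hBb⟩ := Finset.exists_subset_card_eq (s := K \ X) (n := b) (by omega)
  have key : ∀ Y Z : Finset α, Z ⊆ Y → Y.card = Z.card + Z.card → ∀ v : α → ℤ,
      (∀ e ∈ Z, v e = 1) → (∀ e ∈ Y, e ∉ Z → v e = -1) → ∑ e ∈ Y, v e = 0 := by
    intro Y Z hZY hc v hv1 hv2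
    have h1 : ∑ e ∈ Y ∩ Z, v e = Z.card := by
      rw [Finset.inter_eq_right.2 hZY, Finset.sum_congr rfl hv1]
      simp
    have h2 : ∑ e ∈ Y \ Z, v e = -((Y \ Z).card : ℤ) := by
      rw [Finset.sum_congr rfl (g := fun _ => (-1 : ℤ)) fun e he =>
        hv2 e (Finset.mem_sdiff.1 he).1 (Finset.mem_sdiff.1 he).2]
      simp
    have h3 := Finset.card_sdiff_add_card_eq_card hZY
    have h4 := sum_inter_add_sum_sdiff v Y Z
    omega
  have hAB : ∀ e ∈ X, e ∉ B := fun e he heB => (Finset.mem_sdiff.1 (hB heB)).2 he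
  have hBA : ∀ e ∈ K \ X, e ∉ A := fun e he heA => (Finset.mem_sdiff.1 he).2 (hA heA)
  refine ⟨fun e => if e ∈ A ∨ e ∈ B then 1 else -1, fun e => ?_, ?_, ?_⟩
  · split_ifs <;> simp
  · refine key X A hA (by omega) _ (fun e he => by simp [he]) fun e he he' => ?_
    simp [he', hAB e he]
  · refine key _ B hB (by omega) _ (fun e he => by simp [he]) fun e he he' => ?_
    simp [he', hBA e he]

end IsBalanced

/-- A family of subsets of `K` with slacks `s`, any two of which are nearly complementary in `K`
compared with the slacks. -/
structure IsSlackFamily (K : Finset α) (H : Set (Finset α)) (s : Finset α → ℤ) : Prop where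
  subset : ∀ F ∈ H, F ⊆ K
  nonneg : ∀ F ∈ H, 0 ≤ s F
  parity : ∀ F ∈ H, (2 : ℤ) ∣ s F - F.card
  card_le : ∀ F ∈ H, ∀ G ∈ H, F ≠ G → ((F ∩ G).card + (K \ (F ∪ G)).card : ℤ) ≤ s F + s G

namespace IsSlackFamily

variable {K X : Finset α} {H : Set (Finset α)} {s : Finset α → ℤ} {v : α → ℤ}

/-- Since v(K) = 0, v(F) + v(G) = v(F ∩ G) + v(F ∪ G) = v(F ∩ G) - v(K \ (F ∪ G)), and each term is
bounded by a cardinality. -/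
lemma sum_add_sum_le (hH : IsSlackFamily K H s) (hX : X ⊆ K) (hv : IsBalanced K X v)
    {F G : Finset α} (hF : F ∈ H) (hG : G ∈ H) (hFG : F ≠ G) :
    ∑ e ∈ F, v e + ∑ e ∈ G, v e ≤ s F + s G := by
  have h1 := hv.isSign.sum_le_card (F ∩ G)
  have h2 := hv.isSign.neg.sum_le_card (K \ (F ∪ G))
  have h3 := Finset.sum_sdiff (f := v) (Finset.union_subset (hH.subset F hF) (hH.subset G hG))
  have h4 := Finset.sum_union_inter (f := v) (s₁ := F) (s₂ := G)
  have h5 := hv.sum_ground hX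
  have h6 := hH.card_le F hF G hG hFG
  simp only [Pi.neg_apply, Finset.sum_neg_distrib] at h2
  omega

lemma neg_le_sum_add_sum (hH : IsSlackFamily K H s) (hX : X ⊆ K) (hv : IsBalanced K X v)
    {F G : Finset α} (hF : F ∈ H) (hG : G ∈ H) (hFG : F ≠ G) :
    -(s F + s G) ≤ ∑ e ∈ F, v e + ∑ e ∈ G, v e := by
  have := hH.sum_add_sum_le hX hv.neg hF hG hFG
  simp only [Pi.neg_apply, Finset.sum_neg_distrib] at this
  omega

/-- Both numbers have the parity of |F|. Hence a violated bound is missed by at least 2, which is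
the effect of one exchange. -/
lemma parity_sum (hH : IsSlackFamily K H s) (hv : IsSign v) {F : Finset α} (hF : F ∈ H) :
    (2 : ℤ) ∣ ∑ e ∈ F, v e - s F := by
  have h1 := hv.two_dvd_sum_sub_card F
  have h2 := hH.parity F hF
  omega

/-- Without an exchange that keeps the sums over the atoms of `F` and `X` and increases the sum
over `J`, the latter is not too small. -/
lemma exists_exchange (hH : IsSlackFamily K H s) (hX : X ⊆ K) (hv : IsBalanced K X v)
    {F J : Finset α} (hJ : J ∈ H) (h1 : 0 ≤ ∑ e ∈ X ∩ F, v e)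
    (h2 : 0 ≤ ∑ e ∈ (K \ X) ∩ F, v e)
    (h : ∑ e ∈ J, v e < -(∑ e ∈ X ∩ F, v e + ∑ e ∈ (K \ X) ∩ F, v e)) :
    ∃ p q, v p = 1 ∧ v q = -1 ∧ p ∈ K ∧ q ∈ K ∧ (p ∈ X ↔ q ∈ X) ∧ (p ∈ F ↔ q ∈ F) ∧
      p ∉ J ∧ q ∈ J := by
  have hJK := hH.subset J hJ
  have s1 : (J ∩ X) ∩ F = X ∩ F ∩ J := by ext; simp only [Finset.mem_inter]; tauto
  have s2 : (J ∩ X) \ F = (X \ F) ∩ J := by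
    ext; simp only [Finset.mem_inter, Finset.mem_sdiff]; tauto
  have s3 : (J \ X) ∩ F = (K \ X) ∩ F ∩ J := by
    ext e
    have : e ∈ J → e ∈ K := @hJK e
    simp only [Finset.mem_inter, Finset.mem_sdiff]
    clear * - this
    tauto
  have s4 : (J \ X) \ F = ((K \ X) \ F) ∩ J := by
    ext e
    have : e ∈ J → e ∈ K := @hJK e
    simp only [Finset.mem_inter, Finset.mem_sdiff]
    clear * - this
    tauto
  by_contra! hc
  -- Without an exchange, each atom A of X and F contributes at least min(0, v(A)) to v(J). The four
  -- values v(A) are a, -a, b, -b with a, b ≥ 0, so v(J) ≥ -(a + b).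
  have key : ∀ A : Finset α, A ⊆ K → (∀ p ∈ A, ∀ q ∈ A, (p ∈ X ↔ q ∈ X) ∧ (p ∈ F ↔ q ∈ F)) →
      0 ≤ ∑ e ∈ A ∩ J, v e ∨ ∑ e ∈ A, v e ≤ ∑ e ∈ A ∩ J, v e := by
    intro A hAK hA
    refine hv.isSign.sum_inter_nonneg_or_le A J fun p hp q hq hvp hvq => ?_
    rw [Finset.mem_sdiff] at hp
    rw [Finset.mem_inter] at hq
    have := hA p hp.1 q hq.1
    exact hc p q hvp hvq (hAK hp.1) (hAK hq.1) this.1 this.2 hp.2 hq.2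
  have k1 := key (X ∩ F) (fun e he => hX (Finset.mem_inter.1 he).1)
    (fun p hp q hq => by simp only [Finset.mem_inter] at hp hq; tauto)
  have k2 := key (X \ F) (fun e he => hX (Finset.mem_sdiff.1 he).1)
    (fun p hp q hq => by simp only [Finset.mem_sdiff] at hp hq; tauto)
  have k3 := key ((K \ X) ∩ F) (fun e he => (Finset.mem_sdiff.1 (Finset.mem_inter.1 he).1).1)
    (fun p hp q hq => by simp only [Finset.mem_inter, Finset.mem_sdiff] at hp hq; tauto)
  have k4 := key ((K \ X) \ F) (fun e he => (Finset.mem_sdiff.1 (Finset.mem_sdiff.1 he).1).1)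
    (fun p hp q hq => by simp only [Finset.mem_sdiff] at hp hq; tauto)
  have e1 := sum_inter_add_sum_sdiff v X F
  have e2 := sum_inter_add_sum_sdiff v (K \ X) F
  have e3 := sum_inter_add_sum_sdiff v J X
  have e4 := sum_inter_add_sum_sdiff v (J ∩ X) F
  have e5 := sum_inter_add_sum_sdiff v (J \ X) F
  rw [s1, s2] at e4
  rw [s3, s4] at e5
  rw [hv.sum_left] at e1
  rw [hv.sum_right] at e2
  clear key hc
  generalize ∑ e ∈ X ∩ F, v e = a at *
  generalize ∑ e ∈ (K \ X) ∩ F, v e = b at *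
  generalize ∑ e ∈ X ∩ F ∩ J, v e = a₁ at *
  generalize ∑ e ∈ (X \ F) ∩ J, v e = a₂ at *
  generalize ∑ e ∈ (K \ X) ∩ F ∩ J, v e = b₁ at *
  generalize ∑ e ∈ ((K \ X) \ F) ∩ J, v e = b₂ at *
  omega

/-- If the sum over `F` is at its upper bound, with nonnegative contributions of `X` and of its
complement, and all violated sets have at least the slack of `F`, then exchanges that keep the
sums over the atoms of `F` and `X` lead to a vector without violated sets. -/
lemma exists_good_of_tight (hH : IsSlackFamily K H s) (hX : X ⊆ K) {F : Finset α} (hF : F ∈ H)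
    (hmin : ∀ G ∈ H, ∀ w, IsBalanced K X w → s G < ∑ e ∈ G, w e → s F ≤ s G)
    (hv : IsBalanced K X v) (h1 : 0 ≤ ∑ e ∈ X ∩ F, v e) (h2 : 0 ≤ ∑ e ∈ (K \ X) ∩ F, v e)
    (h : ∑ e ∈ X ∩ F, v e + ∑ e ∈ (K \ X) ∩ F, v e = s F) :
    ∃ w, IsBalanced K X w ∧ ∀ G ∈ H, |∑ e ∈ G, w e| ≤ s G := by
  have hsplit := fun w => sum_inter_add_sum_sdiff_inter w X (hH.subset F hF)
  -- As F is at its upper bound, `sum_add_sum_le` leaves no room for another set above its own.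
  have hneg : ∀ w, IsBalanced K X w → ∑ e ∈ F, w e = s F → ∀ G ∈ H, ¬ |∑ e ∈ G, w e| ≤ s G →
      ∑ e ∈ G, w e < - s G := by
    intro w hw hwF G hG hG'
    by_contra! hc
    rw [abs_le, not_and_or] at hG'
    have hFG : F ≠ G := by
      rintro rfl
      have := hH.nonneg F hF
      omega
    have := hH.sum_add_sum_le hX hw hF hG hFG
    omega
  by_cases hgood : ∀ G ∈ H, |∑ e ∈ G, v e| ≤ s G
  · exact ⟨v, hv, hgood⟩
  push Not at hgood
  obtain ⟨J, hJ, hvJ⟩ := hgood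
  replace hvJ := hneg v hv (by rw [← hsplit, h]) J hJ (by omega)
  -- J is violated from below by v, hence from above by -v, so minimality of the slack of F applies.
  -- It gives v(J) < -s(F), as `exists_exchange` requires.
  have hFJ : s F ≤ s J := hmin J hJ (-v) hv.neg (by simp; omega)
  have hJ0 := hH.nonneg J hJ
  induction hn : (∑ e ∈ J, v e).natAbs using Nat.strong_induction_on generalizing v with
  | _ n ih =>
  obtain ⟨p, q, hp, hq, hpK, hqK, hpqX, hpqF, hpJ, hqJ⟩ :=
    hH.exists_exchange hX hv hJ h1 h2 (by omega)
  have hw := hv.flip hp hq hpK hqK hpqX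
  have e1 : ∑ e ∈ X ∩ F, flip v p q e = ∑ e ∈ X ∩ F, v e :=
    sum_flip_of_iff hp hq (by simp [hpqX, hpqF])
  have e2 : ∑ e ∈ (K \ X) ∩ F, flip v p q e = ∑ e ∈ (K \ X) ∩ F, v e :=
    sum_flip_of_iff hp hq (by simp [hpqX, hpqF, hpK, hqK])
  have e3 : ∑ e ∈ J, flip v p q e = ∑ e ∈ J, v e + 2 := by
    rw [sum_flip hp hq, if_pos hqJ, if_neg hpJ, sub_zero]
  by_cases hgood : ∀ G ∈ H, |∑ e ∈ G, flip v p q e| ≤ s G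
  · exact ⟨_, hw, hgood⟩
  push Not at hgood
  obtain ⟨G, hG, hvG⟩ := hgood
  replace hvG := hneg _ hw (by rw [← hsplit, e1, e2, h]) G hG (by omega)
  by_cases hGJ : G = J
  · subst hGJ
    exact ih _ (by omega) hw (by omega) (by omega) (by omega) hvG rfl
  -- By parity the sum over J is still at most -s(J) after one exchange, and the sum over G is at
  -- most -s(G) - 2. Together they are too small for two different sets.
  · have := hH.neg_le_sum_add_sum hX hw hG hJ hGJ
    have p1 := hH.parity_sum hw.isSign hG
    have p2 := hH.parity_sum hw.isSign hJ
    omega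

/-- A violated set `F` can be made tight, with nonnegative contributions of `X` and of its
complement, unless the slack of `F` is zero. -/
lemma exists_tight (hH : IsSlackFamily K H s) (hX : X ⊆ K) {F : Finset α} (hF : F ∈ H)
    (hv : IsBalanced K X v) (h : s F ≤ ∑ e ∈ X ∩ F, v e + ∑ e ∈ (K \ X) ∩ F, v e) :
    ∃ w, IsBalanced K X w ∧ ∑ e ∈ X ∩ F, w e + ∑ e ∈ (K \ X) ∩ F, w e = s F ∧
      (s F = 0 ∨ 0 ≤ ∑ e ∈ X ∩ F, w e ∧ 0 ≤ ∑ e ∈ (K \ X) ∩ F, w e) := by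
  have hFK := hH.subset F hF
  have hs0 := hH.nonneg F hF
  have hpar : ∀ w, IsBalanced K X w →
      (2 : ℤ) ∣ ∑ e ∈ X ∩ F, w e + ∑ e ∈ (K \ X) ∩ F, w e - s F := by
    intro w hw
    have h1 := hH.parity_sum hw.isSign hF
    rwa [← sum_inter_add_sum_sdiff_inter w X hFK] at h1
  -- The sum over Y ∩ F can be moved by 2 towards or past zero: since v(Y) = 0, the part Y \ F
  -- supplies an entry of the opposite sign.
  have down : ∀ Y Z : Finset α, Y = X ∧ Z = K \ X ∨ Y = K \ X ∧ Z = X → ∀ w, IsBalanced K X w →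
      (0 < ∑ e ∈ Y ∩ F, w e → ∃ w', IsBalanced K X w' ∧
        ∑ e ∈ Y ∩ F, w' e = ∑ e ∈ Y ∩ F, w e - 2 ∧ ∑ e ∈ Z ∩ F, w' e = ∑ e ∈ Z ∩ F, w e) ∧
      (∑ e ∈ Y ∩ F, w e < 0 → ∃ w', IsBalanced K X w' ∧
        ∑ e ∈ Y ∩ F, w' e = ∑ e ∈ Y ∩ F, w e + 2 ∧ ∑ e ∈ Z ∩ F, w' e = ∑ e ∈ Z ∩ F, w e) := by
    intro Y Z hYZ w hw
    have hY0 : ∑ e ∈ Y, w e = 0 := by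
      rcases hYZ with ⟨rfl, -⟩ | ⟨rfl, -⟩
      exacts [hw.sum_left, hw.sum_right]
    have hYK : Y ⊆ K := by
      rcases hYZ with ⟨rfl, -⟩ | ⟨rfl, -⟩
      exacts [hX, Finset.sdiff_subset]
    have hYX : ∀ p ∈ Y, ∀ q ∈ Y, (p ∈ X ↔ q ∈ X) := by
      rcases hYZ with ⟨rfl, -⟩ | ⟨rfl, -⟩ <;> intro p hp q hq
      · tauto
      · simp only [Finset.mem_sdiff] at hp hq; tauto
    have hZ : ∀ p ∈ Y, p ∉ Z := by
      rcases hYZ with ⟨rfl, rfl⟩ | ⟨rfl, rfl⟩ <;> intro p hp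
      · simp [hp]
      · exact (Finset.mem_sdiff.1 hp).2
    have hsum := sum_inter_add_sum_sdiff w Y F
    constructor <;> intro h0
    · obtain ⟨p, hp, hwp⟩ := hw.isSign.exists_eq_one h0
      obtain ⟨q, hq, hwq⟩ := hw.isSign.exists_eq_neg_one (A := Y \ F) (by omega)
      rw [Finset.mem_inter] at hp
      rw [Finset.mem_sdiff] at hq
      refine ⟨flip w p q, hw.flip hwp hwq (hYK hp.1) (hYK hq.1) (hYX p hp.1 q hq.1), ?_, ?_⟩
      · rw [sum_flip hwp hwq]; simp [hp, hq]
      · rw [sum_flip hwp hwq]; simp [hZ p hp.1, hZ q hq.1]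
    · obtain ⟨q, hq, hwq⟩ := hw.isSign.exists_eq_neg_one h0
      obtain ⟨p, hp, hwp⟩ := hw.isSign.exists_eq_one (A := Y \ F) (by omega)
      rw [Finset.mem_inter] at hq
      rw [Finset.mem_sdiff] at hp
      refine ⟨flip w p q, hw.flip hwp hwq (hYK hp.1) (hYK hq.1) (hYX p hp.1 q hq.1), ?_, ?_⟩
      · rw [sum_flip hwp hwq]; simp [hp, hq]
      · rw [sum_flip hwp hwq]; simp [hZ p hp.1, hZ q hq.1]
  induction hn : (∑ e ∈ X ∩ F, v e).natAbs + (∑ e ∈ (K \ X) ∩ F, v e).natAbs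
    using Nat.strong_induction_on generalizing v with
  | _ n ih =>
  have d1 := down X (K \ X) (Or.inl ⟨rfl, rfl⟩)
  have d2 := down (K \ X) X (Or.inr ⟨rfl, rfl⟩)
  have hp := hpar v hv
  by_cases hgt : s F < ∑ e ∈ X ∩ F, v e + ∑ e ∈ (K \ X) ∩ F, v e
  · by_cases ha : 2 ≤ ∑ e ∈ X ∩ F, v e
    · obtain ⟨w, hw, hw1, hw2⟩ := (d1 v hv).1 (by omega)
      exact ih _ (by omega) hw (by omega) rfl
    by_cases hb : 2 ≤ ∑ e ∈ (K \ X) ∩ F, v e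
    · obtain ⟨w, hw, hw1, hw2⟩ := (d2 v hv).1 (by omega)
      exact ih _ (by omega) hw (by omega) rfl
    -- Parity leaves only contributions 1 and 1 with slack 0; the exchange yields -1 and 1. This is
    -- why zero slack is exempt from the sign condition.
    obtain ⟨w, hw, hw1, hw2⟩ := (d1 v hv).1 (by omega)
    exact ⟨w, hw, by omega, Or.inl (by omega)⟩
  · by_cases hs : s F = 0
    · exact ⟨v, hv, by omega, Or.inl hs⟩
    by_cases ha : ∑ e ∈ X ∩ F, v e < 0
    -- The other contribution exceeds s(F) > 0, so it is at least 2. Moving 2 across keeps the total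
    -- and lowers the sum of absolute values.
    · obtain ⟨w, hw, hw1, hw2⟩ := (d1 v hv).2 ha
      obtain ⟨u, hu, hu1, hu2⟩ := (d2 w hw).1 (by omega)
      exact ih _ (by omega) hu (by omega) rfl
    by_cases hb : ∑ e ∈ (K \ X) ∩ F, v e < 0
    · obtain ⟨w, hw, hw1, hw2⟩ := (d2 v hv).2 hb
      obtain ⟨u, hu, hu1, hu2⟩ := (d1 w hw).1 (by omega)
      exact ih _ (by omega) hu (by omega) rfl
    exact ⟨v, hv, by omega, Or.inr ⟨by omega, by omega⟩⟩

/-- Some balanced sign vector has no violated set. -/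
theorem exists_balanced (hH : IsSlackFamily K H s) (hX : X ⊆ K) (hX2 : Even X.card)
    (hKX : Even (K \ X).card) :
    ∃ v, IsBalanced K X v ∧ ∀ F ∈ H, |∑ e ∈ F, v e| ≤ s F := by
  obtain ⟨v, hv⟩ := IsBalanced.exists_of_even hX2 hKX
  -- Only violations from above need to be considered, as negation turns the others into these.
  by_cases hviol : ∃ n : ℕ, ∃ F ∈ H, (s F).toNat = n ∧
      ∃ w, IsBalanced K X w ∧ s F < ∑ e ∈ F, w e
  · classical
    obtain ⟨F, hF, hFn, w, hw, hwF⟩ := Nat.find_spec hviol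
    have hmin : ∀ G ∈ H, ∀ u, IsBalanced K X u → s G < ∑ e ∈ G, u e → s F ≤ s G := by
      intro G hG u hu huG
      have := Nat.find_min' hviol ⟨G, hG, rfl, u, hu, huG⟩
      have := hH.nonneg G hG
      omega
    have hsplit := fun w => sum_inter_add_sum_sdiff_inter w X (hH.subset F hF)
    obtain ⟨u, hu, hu1, hu2⟩ := hH.exists_tight hX hF hw (by rw [hsplit]; omega)
    rcases hu2 with h0 | ⟨ha, hb⟩
    -- With u(F) = s(F) = 0, the two-set bounds become the bounds on G alone.
    · refine ⟨u, hu, fun G hG => ?_⟩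
      rw [hsplit] at hu1
      by_cases hFG : F = G
      · subst hFG
        rw [hu1, h0]; simp
      · have h1 := hH.sum_add_sum_le hX hu hF hG hFG
        have h2 := hH.neg_le_sum_add_sum hX hu hF hG hFG
        rw [abs_le]
        constructor <;> omega
    · exact hH.exists_good_of_tight hX hF hmin hu ha hb hu1
  · refine ⟨v, hv, fun F hF => abs_le.2 ⟨?_, ?_⟩⟩
    · by_contra! hc
      exact hviol ⟨_, F, hF, rfl, -v, hv.neg, by simp; omega⟩
    · by_contra! hc
      exact hviol ⟨_, F, hF, rfl, v, hv, hc⟩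

end IsSlackFamily

end SignVector

/-! ### Tight sets, separators and flacets in terms of the rank function -/

namespace Matroid

variable {α : Type*} {M : Matroid α} {A B D F K L U X Y : Set α}

section rank

lemma coe_rkNat (M : Matroid α) [M.RankFinite] (A : Set α) : (M.rkNat A : ℕ∞) = M.eRk A :=
  ENat.natCast_toNat (M.eRk_lt_top_iff.2 (RankFinite.isRkFinite A)).ne

lemma rkNat_empty (M : Matroid α) : M.rkNat ∅ = 0 := by
  simp [rkNat]

variable [M.Finite]

lemma rkNat_mono (h : X ⊆ Y) : M.rkNat X ≤ M.rkNat Y := by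
  have := M.eRk_mono h
  rw [← coe_rkNat, ← coe_rkNat] at this
  exact_mod_cast this

lemma rkNat_inter_add_rkNat_union_le (M : Matroid α) [M.Finite] (X Y : Set α) :
    M.rkNat (X ∩ Y) + M.rkNat (X ∪ Y) ≤ M.rkNat X + M.rkNat Y := by
  have := M.eRk_inter_add_eRk_union_le X Y
  simp only [← coe_rkNat] at this
  exact_mod_cast this

lemma rkNat_le_add_sdiff (M : Matroid α) [M.Finite] (h : X ⊆ Y) :
    M.rkNat Y ≤ M.rkNat X + M.rkNat (Y \ X) := by
  have := M.rkNat_inter_add_rkNat_union_le X (Y \ X)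
  rw [Set.union_sdiff_cancel h] at this
  omega

lemma finite_of_subset_ground (h : X ⊆ M.E) : X.Finite := M.ground_finite.subset h

lemma rkNat_le_ncard (h : X ⊆ M.E) : M.rkNat X ≤ X.ncard := by
  have := M.eRk_le_encard X
  rw [← coe_rkNat, ← (finite_of_subset_ground h).cast_ncard_eq] at this
  exact_mod_cast this

lemma Indep.rkNat_eq (h : M.Indep X) : M.rkNat X = X.ncard := by
  have := h.eRk_eq_encard
  rw [← coe_rkNat, ← (finite_of_subset_ground h.subset_ground).cast_ncard_eq] at this
  exact_mod_cast this

lemma indep_of_ncard_le_rkNat (hX : X ⊆ M.E) (h : X.ncard ≤ M.rkNat X) : M.Indep X := by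
  refine (RankFinite.isRkFinite X).indep_of_encard_le_eRk ?_
  rw [← coe_rkNat, ← (finite_of_subset_ground hX).cast_ncard_eq]
  exact_mod_cast h

lemma Indep.ncard_inter_le (h : M.Indep B) (A : Set α) : (B ∩ A).ncard ≤ M.rkNat A := by
  rw [← (h.subset Set.inter_subset_left).rkNat_eq]
  exact rkNat_mono Set.inter_subset_right

lemma IsBase.ncard_eq (h : M.IsBase B) : B.ncard = M.rkNat M.E := by
  have := h.encard_eq_eRank
  rw [← eRk_ground, ← coe_rkNat,
    ← (finite_of_subset_ground h.subset_ground).cast_ncard_eq] at this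
  exact_mod_cast this

lemma Indep.isBase_of_ncard (h : M.Indep B) (hB : B.ncard = M.rkNat M.E) : M.IsBase B := by
  obtain ⟨B', hB', hBB'⟩ := h.exists_isBase_superset
  rwa [Set.eq_of_subset_of_ncard_le hBB' (by rw [hB'.ncard_eq, hB])
    (finite_of_subset_ground hB'.subset_ground)]

lemma ncard_inter_add (hB : B.Finite) (h : X ⊆ Y) :
    (B ∩ X).ncard + (B ∩ (Y \ X)).ncard = (B ∩ Y).ncard := by
  rw [← Set.ncard_union_eq (by
    rw [Set.disjoint_left]; intro e he he'; exact he'.2.2 he.2)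
    (hB.subset Set.inter_subset_left) (hB.subset Set.inter_subset_left)]
  rw [← Set.inter_union_distrib_left, Set.union_sdiff_cancel h]

end rank

/-- The members of `B` in `A` span `A`. -/
def IsTight (M : Matroid α) (B A : Set α) : Prop := (B ∩ A).ncard = M.rkNat A

lemma isTight_empty (M : Matroid α) (B : Set α) : M.IsTight B ∅ := by
  simp [IsTight, rkNat_empty]

/-- A union of connected components, in terms of the rank function. -/
def IsRkSeparator (M : Matroid α) (K : Set α) : Prop :=
  K ⊆ M.E ∧ M.rkNat K + M.rkNat (M.E \ K) = M.rkNat M.E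

/-- The minor that is obtained by restriction to `U` and contraction of `L` is connected, in terms
of the rank function. -/
def IsMinorConnected (M : Matroid α) (L U : Set α) : Prop :=
  ∀ A ⊆ U \ L, M.rkNat (L ∪ A) + M.rkNat (U \ A) = M.rkNat L + M.rkNat U → A = ∅ ∨ A = U \ L

lemma isMinorConnected_empty :
    M.IsMinorConnected ∅ K ↔
      ∀ A ⊆ K, M.rkNat A + M.rkNat (K \ A) = M.rkNat K → A = ∅ ∨ A = K := by
  simp [IsMinorConnected, rkNat_empty]

/-- A set that defines a facet of the base polytope of the connected component `K`, other than the
facets given by bounds on a single coordinate. -/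
structure IsFlacet (M : Matroid α) (K F : Set α) : Prop where
  subset : F ⊆ K
  restrict : M.IsMinorConnected ∅ F
  contract : M.IsMinorConnected F K
  lt_ncard : M.rkNat F < F.ncard
  lt_rkNat : M.rkNat F < M.rkNat K

lemma IsRkSeparator.compl (hK : M.IsRkSeparator K) : M.IsRkSeparator (M.E \ K) := by
  refine ⟨Set.sdiff_subset, ?_⟩
  rw [Set.sdiff_sdiff_cancel_left hK.1, add_comm, hK.2]

variable [M.Finite]

lemma Indep.exists_isTight (hB : M.Indep X) (hA : A ⊆ M.E) (hXA : X ⊆ A) :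
    ∃ B, M.IsBase B ∧ M.IsTight B A ∧ X ⊆ B := by
  obtain ⟨I, hI, hXI⟩ := hB.subset_isBasis_of_subset hXA hA
  obtain ⟨B, hB, hIB⟩ := hI.indep.exists_isBase_superset
  refine ⟨B, hB, ?_, hXI.trans hIB⟩
  refine le_antisymm (hB.indep.ncard_inter_le A) ?_
  have h1 : M.rkNat A = I.ncard := by
    rw [← hI.indep.rkNat_eq, rkNat, rkNat, hI.eRk_eq_eRk]
  rw [h1]
  exact Set.ncard_le_ncard (Set.subset_inter hIB hI.subset)
    ((finite_of_subset_ground hB.subset_ground).subset Set.inter_subset_left)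

lemma exists_isTight (hA : A ⊆ M.E) : ∃ B, M.IsBase B ∧ M.IsTight B A := by
  obtain ⟨B, hB, h, -⟩ := M.empty_indep.exists_isTight hA (Set.empty_subset A)
  exact ⟨B, hB, h⟩

/-- If `B` spans `U` but not the subset `D` of `U`, then some exchange inside `U` increases
`B ∩ D`. -/
lemma IsBase.exists_exchange_of_not_isTight (hB : M.IsBase B) (hU : U ⊆ M.E)
    (hBU : M.IsTight B U) (hD : D ⊆ U) (hBD : ¬ M.IsTight B D) :
    ∃ f ∈ D \ B, ∃ e ∈ (B ∩ U) \ D, M.IsBase (insert f (B \ {e})) := by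
  have hBfin := finite_of_subset_ground hB.subset_ground
  have hlt := lt_of_le_of_ne (hB.indep.ncard_inter_le D) hBD
  obtain ⟨J, hJ⟩ := M.exists_isBasis D (hD.trans hU)
  have hJfin := finite_of_subset_ground hJ.indep.subset_ground
  have hJD : J.ncard = M.rkNat D := by
    rw [← hJ.indep.rkNat_eq, rkNat, rkNat, hJ.eRk_eq_eRk]
  have hBD_indep := hB.indep.subset (Set.inter_subset_left (t := D))
  obtain ⟨f, hf, hfI⟩ := hBD_indep.exists_insert_of_encard_lt hJ.indep (by
      rw [← (hBfin.subset Set.inter_subset_left).cast_ncard_eq, ← hJfin.cast_ncard_eq]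
      exact_mod_cast hJD ▸ hlt)
  have hfD := hJ.subset hf.1
  have hfB : f ∉ B := fun h => hf.2 ⟨h, hfD⟩
  -- B ∩ D together with f is completed by elements of B only, so the new base arises from B by a
  -- single exchange.
  obtain ⟨B', hB', hsub, hB'sub⟩ := hfI.exists_isBase_subset_union_isBase hB
  have hfB' : f ∈ B' := hsub (Set.mem_insert f _)
  obtain ⟨e, heB, heB'⟩ : ∃ e ∈ B, e ∉ B' := by
    by_contra! hc
    rw [← hB.eq_of_subset_isBase hB' hc] at hfB'
    exact hfB hfB'
  have heq : B' = insert f (B \ {e}) := by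
    refine Set.eq_of_subset_of_ncard_le ?_ ?_ ((hBfin.subset Set.sdiff_subset).insert f)
    · intro x hx
      rcases hB'sub hx with (rfl | h) | h
      · exact Set.mem_insert _ _
      · exact Set.mem_insert_of_mem _ ⟨h.1, fun h' => heB' (h' ▸ hx)⟩
      · exact Set.mem_insert_of_mem _ ⟨h, fun h' => heB' (h' ▸ hx)⟩
    · rw [Set.ncard_exchange hfB heB, hB.ncard_eq, hB'.ncard_eq]
  refine ⟨f, ⟨hfD, hfB⟩, e, ⟨⟨heB, ?_⟩, fun h => heB' (hsub (Set.mem_insert_of_mem _ ⟨heB, h⟩))⟩,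
    heq ▸ hB'⟩
  by_contra heU
  have h1 := hB'.indep.ncard_inter_le U
  have h2 : insert f (B ∩ U) ⊆ B' ∩ U := by
    rw [heq]
    rintro x (rfl | hx)
    · exact ⟨Set.mem_insert _ _, hD hfD⟩
    · exact ⟨Set.mem_insert_of_mem _ ⟨hx.1, fun h => heU (h ▸ hx.2)⟩, hx.2⟩
  have h3 := Set.ncard_le_ncard h2
    ((finite_of_subset_ground hB'.subset_ground).subset Set.inter_subset_left)
  rw [Set.ncard_insert_of_notMem (fun h => hfB h.1) (hBfin.subset Set.inter_subset_left), hBU] at h3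
  omega

namespace IsRkSeparator

/-- The bounds |B ∩ K| ≤ r(K) and |B \ K| ≤ r(E \ K) add up to r(E) = |B|, so both are equalities.
-/
lemma isTight (hK : M.IsRkSeparator K) (hB : M.IsBase B) : M.IsTight B K := by
  have h1 := hB.indep.ncard_inter_le K
  have h2 := hB.indep.ncard_inter_le (M.E \ K)
  have h3 := ncard_inter_add (finite_of_subset_ground hB.subset_ground) hK.1
  rw [Set.inter_eq_left.2 hB.subset_ground, hB.ncard_eq] at h3
  have := hK.2
  unfold IsTight
  omega

/-- The part in a separator of an independent set can be combined with the rest of another one. -/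
lemma indep_union (hK : M.IsRkSeparator K) (hX : M.Indep X) (hXK : X ⊆ K) (hY : M.Indep Y)
    (hYK : Y ⊆ M.E \ K) : M.Indep (X ∪ Y) := by
  obtain ⟨B₁, hB₁, ht₁, h₁⟩ := hX.exists_isTight hK.1 hXK
  obtain ⟨B₂, hB₂, ht₂, h₂⟩ := hY.exists_isTight Set.sdiff_subset hYK
  have hsub : B₁ ∩ K ∪ B₂ ∩ (M.E \ K) ⊆ M.E :=
    Set.union_subset (Set.inter_subset_right.trans hK.1)
      (Set.inter_subset_right.trans Set.sdiff_subset)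
  refine Indep.subset (indep_of_ncard_le_rkNat hsub ?_)
    (Set.union_subset_union (Set.subset_inter h₁ hXK) (Set.subset_inter h₂ hYK))
  have hle : (B₁ ∩ K ∪ B₂ ∩ (M.E \ K)).ncard ≤ M.rkNat M.E := by
    refine (Set.ncard_union_le _ _).trans ?_
    rw [ht₁, ht₂, hK.2]
  refine hle.trans ?_
  have s1 : M.closure (B₁ ∩ K ∪ B₂ ∩ (M.E \ K)) = M.E := by
    have key : ∀ B A, M.IsBase B → A ⊆ M.E → M.IsTight B A → A ⊆ M.closure (B ∩ A) := by
      intro B A hB hA ht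
      have : M.IsBasis (B ∩ A) A := by
        refine (hB.indep.subset Set.inter_subset_left).isBasis_of_eRk_ge
          ((finite_of_subset_ground hA).subset Set.inter_subset_right) Set.inter_subset_right ?_ hA
        rw [← coe_rkNat, ← coe_rkNat, (hB.indep.subset Set.inter_subset_left).rkNat_eq, ht]
      exact this.subset_closure
    refine (M.closure_subset_ground _).antisymm fun e he => ?_
    by_cases heK : e ∈ K
    · exact M.closure_subset_closure Set.subset_union_left (key B₁ K hB₁ hK.1 ht₁ heK)
    · exact M.closure_subset_closure Set.subset_union_right
        (key B₂ _ hB₂ Set.sdiff_subset ht₂ ⟨he, heK⟩)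
  rw [rkNat, rkNat, ← M.eRk_closure_eq (B₁ ∩ K ∪ _), s1]

lemma isBase_union (hK : M.IsRkSeparator K) (hX : M.Indep X) (hXK : X ⊆ K)
    (hXr : X.ncard = M.rkNat K) (hY : M.Indep Y) (hYK : Y ⊆ M.E \ K)
    (hYr : Y.ncard = M.rkNat (M.E \ K)) : M.IsBase (X ∪ Y) := by
  refine (hK.indep_union hX hXK hY hYK).isBase_of_ncard ?_
  rw [Set.ncard_union_eq (Set.disjoint_left.2 fun e he he' => (hYK he').2 (hXK he))
    (finite_of_subset_ground hX.subset_ground) (finite_of_subset_ground hY.subset_ground),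
    hXr, hYr, hK.2]

end IsRkSeparator

/-- A separator of a subset remains one after restriction. -/
lemma rkNat_inter_add_rkNat_sdiff_eq (hF : F ⊆ U) (hA : A ⊆ U)
    (h : M.rkNat A + M.rkNat (U \ A) = M.rkNat U) :
    M.rkNat (F ∩ A) + M.rkNat (F \ A) = M.rkNat F := by
  -- The two submodular inequalities are added; the rank of A ∪ F cancels.
  have h1 := M.rkNat_inter_add_rkNat_union_le A F
  have h2 := M.rkNat_inter_add_rkNat_union_le (A ∪ F) (U \ A)
  have h3 := M.rkNat_le_add_sdiff (Set.inter_subset_left (s := F) (t := A))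
  have e1 : (A ∪ F) ∩ (U \ A) = F \ A := by
    ext e
    have : e ∈ F → e ∈ U := @hF e
    simp only [Set.mem_inter_iff, Set.mem_union, Set.mem_sdiff]
    tauto
  have e2 : (A ∪ F) ∪ (U \ A) = U := by
    ext e
    have : e ∈ F → e ∈ U := @hF e
    have : e ∈ A → e ∈ U := @hA e
    simp only [Set.mem_union, Set.mem_sdiff]
    tauto
  rw [e1, e2] at h2
  rw [Set.inter_comm] at h1
  rw [Set.sdiff_self_inter] at h3
  omega

/-- If `F` is connected in the connected set `K` and the contraction of `F` splits off `K \ G`,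
then `G` is connected. -/
lemma IsMinorConnected.union (hK : M.IsMinorConnected ∅ K) (hF : M.IsMinorConnected ∅ F)
    (hFK : F ⊆ K) (hF0 : F.Nonempty) (hA : A ⊆ K \ F)
    (h : M.rkNat (F ∪ A) + M.rkNat (K \ A) = M.rkNat F + M.rkNat K) :
    M.IsMinorConnected ∅ (F ∪ A) := by
  rw [isMinorConnected_empty] at hK hF ⊢
  have hAK : ∀ e ∈ A, e ∈ K ∧ e ∉ F := fun e he => hA he
  -- A separator of F ∪ A that avoids F also separates K, by submodularity for (F ∪ A) \ G and K \
  -- A. For a general separator, either it or its complement avoids F because F is connected.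
  have key : ∀ G ⊆ F ∪ A, M.rkNat G + M.rkNat ((F ∪ A) \ G) = M.rkNat (F ∪ A) → F ∩ G = ∅ →
      G = ∅ := by
    intro G hG hGr hFG
    have hGA : ∀ e ∈ G, e ∈ A := fun e he => (hG he).resolve_left fun heF =>
      Set.notMem_empty e (hFG ▸ ⟨heF, he⟩)
    have h1 := M.rkNat_inter_add_rkNat_union_le ((F ∪ A) \ G) (K \ A)
    have h2 : M.rkNat F ≤ M.rkNat (((F ∪ A) \ G) ∩ (K \ A)) := by
      refine rkNat_mono fun e he => ⟨⟨Or.inl he, fun h => ?_⟩, hFK he, fun h => (hAK e h).2 he⟩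
      exact (hAK e (hGA e h)).2 he
    have h3 : ((F ∪ A) \ G) ∪ (K \ A) = K \ G := by
      ext e
      have := hAK e
      have := hGA e
      have : e ∈ F → e ∈ K := @hFK e
      simp only [Set.mem_union, Set.mem_sdiff]
      tauto
    have hGK : G ⊆ K := fun e he => (hAK e (hGA e he)).1
    have h4 := M.rkNat_le_add_sdiff hGK
    rw [h3] at h1
    refine (hK G hGK (by omega)).resolve_right ?_
    rintro rfl
    obtain ⟨e, he⟩ := hF0
    exact (hAK e (hGA e (hFK he))).2 he
  intro G hG hGr
  rcases hF (F ∩ G) Set.inter_subset_left (by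
    rw [Set.sdiff_self_inter]
    exact rkNat_inter_add_rkNat_sdiff_eq Set.subset_union_left hG hGr) with h0 | h0
  · exact Or.inl (key G hG hGr h0)
  · right
    have := key ((F ∪ A) \ G) Set.sdiff_subset (by
      rw [Set.sdiff_sdiff_cancel_left hG, add_comm, hGr]) (by
        ext e
        have : e ∈ F → e ∈ F ∩ G := fun he => h0.symm ▸ he
        simp only [Set.mem_inter_iff, Set.mem_union, Set.mem_sdiff,
          Set.mem_empty_iff_false] at this ⊢
        tauto)
    exact hG.antisymm (Set.sdiff_eq_empty.1 this)

/-- A dependent set of the cardinality of a basis of `K` violates the rank condition of a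
flacet. -/
lemma exists_isFlacet (hK : M.IsMinorConnected ∅ K) (hKE : K ⊆ M.E) (hBK : B ⊆ K)
    (hBr : B.ncard = M.rkNat K) (hB : ¬ M.Indep B) :
    ∃ F, M.IsFlacet K F ∧ M.rkNat F < (B ∩ F).ncard := by
  have hKfin := finite_of_subset_ground hKE
  have hBfin := hKfin.subset hBK
  have hfin : ∀ P : Set α → Prop, {F | F ⊆ K ∧ P F}.Finite := fun P =>
    hKfin.finite_subsets.subset fun F hF => hF.1
  have hB0 : B ∈ {F | F ⊆ K ∧ M.rkNat F < (B ∩ F).ncard} := by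
    refine ⟨hBK, ?_⟩
    by_contra! hc
    rw [Set.inter_self] at hc
    exact hB (indep_of_ncard_le_rkNat (hBK.trans hKE) hc)
  obtain ⟨F₀, hF₀⟩ := (hfin _).exists_minimal ⟨B, hB0⟩
  -- Rank and |B ∩ ·| are both additive over a separation, so one of its parts is again violated.
  have hF₀c : M.IsMinorConnected ∅ F₀ := by
    rw [isMinorConnected_empty]
    intro A hA hr
    have h1 := ncard_inter_add hBfin hA
    have h2 := hF₀.1.2
    by_cases hAv : M.rkNat A < (B ∩ A).ncard
    · exact Or.inr (hA.antisymm (hF₀.2 ⟨hA.trans hF₀.1.1, hAv⟩ hA))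
    · have := hF₀.2 ⟨Set.sdiff_subset.trans hF₀.1.1,
        (by omega : M.rkNat (F₀ \ A) < (B ∩ (F₀ \ A)).ncard)⟩ Set.sdiff_subset
      left
      rw [Set.eq_empty_iff_forall_notMem]
      exact fun e he => (this (hA he)).2 he
  -- Maximality makes the contraction connected: if A splits it off, then F ∪ A and K \ A are
  -- connected by `IsMinorConnected.union`, and counting shows that one of them is violated.
  obtain ⟨F, hF⟩ :=
    (hfin fun F => M.rkNat F < (B ∩ F).ncard ∧ M.IsMinorConnected ∅ F).exists_maximal
    ⟨F₀, hF₀.1.1, hF₀.1.2, hF₀c⟩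
  obtain ⟨⟨hFK, hFv, hFc⟩, hFmax⟩ := hF
  have hF0 : F.Nonempty := by
    rw [Set.nonempty_iff_ne_empty]
    rintro rfl
    simp at hFv
  refine ⟨F, ⟨hFK, hFc, ?_, ?_, ?_⟩, hFv⟩
  · intro A hA hr
    have hAF : ∀ e ∈ A, e ∈ K ∧ e ∉ F := fun e he => hA he
    have hFAK : F ∪ A ⊆ K := Set.union_subset hFK (hA.trans Set.sdiff_subset)
    have e1 : K \ A = F ∪ (K \ (F ∪ A)) := by
      ext e
      have := hAF e
      have : e ∈ F → e ∈ K := @hFK e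
      simp only [Set.mem_union, Set.mem_sdiff]
      tauto
    have e2 : K \ (K \ (F ∪ A)) = F ∪ A := Set.sdiff_sdiff_cancel_left hFAK
    have h1 := ncard_inter_add hBfin hFAK
    have h2 := ncard_inter_add hBfin (Set.subset_union_left (s := F) (t := K \ (F ∪ A)))
    have e3 : (F ∪ K \ (F ∪ A)) \ F = K \ (F ∪ A) := by
      ext e
      simp only [Set.mem_union, Set.mem_sdiff]
      tauto
    rw [e3, ← e1] at h2
    rw [Set.inter_eq_left.2 hBK] at h1
    by_cases hv : M.rkNat (F ∪ A) < (B ∩ (F ∪ A)).ncard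
    · have := hFmax ⟨hFAK, hv, hK.union hFc hFK hF0 hA hr⟩ Set.subset_union_left
      left
      rw [Set.eq_empty_iff_forall_notMem]
      exact fun e he => (hAF e he).2 (this (Or.inr he))
    · have hc : M.IsMinorConnected ∅ (K \ A) := by
        rw [e1]
        refine hK.union hFc hFK hF0 (Set.sdiff_subset_sdiff_right Set.subset_union_left) ?_
        rw [e2, ← e1, add_comm, hr]
      have := hFmax ⟨Set.sdiff_subset, (by omega : M.rkNat (K \ A) < (B ∩ (K \ A)).ncard), hc⟩
        (e1 ▸ Set.subset_union_left)
      right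
      ext e
      have h3 := hAF e
      have h4 : e ∈ K \ A → e ∈ F := @this e
      simp only [Set.mem_sdiff] at h4 ⊢
      tauto
  · exact hFv.trans_le (Set.ncard_le_ncard Set.inter_subset_right (hKfin.subset hFK))
  · exact hFv.trans_le (hBr ▸ Set.ncard_le_ncard Set.inter_subset_left hBfin)

end Matroid

/-! ### Facets of the base polytope -/

noncomputable section

namespace Matroid

variable {α : Type*} {M : Matroid α} {A B D F G K L U X Y : Set α} {e f i j : α}

/-- The difference of the unit vectors of `i` and `j`. -/
def unitDiff (i j : α) : α → ℝ := ({i} : Set α).indicator 1 - ({j} : Set α).indicator 1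

lemma unitDiff_self (i : α) : unitDiff i i = 0 := sub_self _

lemma unitDiff_sub_unitDiff (i j k : α) : unitDiff i k - unitDiff j k = unitDiff i j := by
  simp [unitDiff]

lemma indicator_exchange_sub (he : e ∈ B) (hf : f ∉ B) :
    (insert f (B \ {e})).indicator (1 : α → ℝ) - B.indicator 1 = unitDiff f e := by
  classical
  have hfe : f ≠ e := fun h => hf (h ▸ he)
  funext x
  simp only [unitDiff, Pi.sub_apply, Set.indicator_apply, Set.mem_insert_iff, Set.mem_sdiff,
    Set.mem_singleton_iff, Pi.one_apply]
  by_cases h1 : x = f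
  · subst h1; simp [hf, hfe]
  · by_cases h2 : x = e
    · subst h2; simp [he, h1]
    · simp [h1, h2]

/-- The sum of the coordinates in a finite set, as a linear map. -/
def coordSum (hF : F.Finite) : (α → ℝ) →ₗ[ℝ] ℝ := ∑ e ∈ hF.toFinset, LinearMap.proj e

lemma coordSum_apply (hF : F.Finite) (x : α → ℝ) : coordSum hF x = ∑ᶠ e ∈ F, x e := by
  rw [finsum_mem_eq_finite_toFinset_sum _ hF]
  simp [coordSum]

lemma coordSum_indicator (hF : F.Finite) (B : Set α) :
    coordSum hF (B.indicator 1) = (B ∩ F).ncard := by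
  classical
  have h : (B ∩ F) = ↑(hF.toFinset.filter (· ∈ B)) := by
    ext; simp [and_comm]
  rw [h, Set.ncard_coe_finset]
  simp [coordSum, Set.indicator_apply, Finset.sum_boole]

lemma coordSum_unitDiff (hF : F.Finite) (i j : α) [Decidable (i ∈ F)] [Decidable (j ∈ F)] :
    coordSum hF (unitDiff i j) = (if i ∈ F then 1 else 0) - (if j ∈ F then 1 else 0) := by
  have h : ∀ k : α, ∀ [Decidable (k ∈ F)],
      ((({k} : Set α) ∩ F).ncard : ℝ) = if k ∈ F then 1 else 0 := by
    intro k _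
    split_ifs with hk
    · rw [Set.inter_eq_left.2 (Set.singleton_subset_iff.2 hk)]; simp
    · rw [Set.singleton_inter_eq_empty.2 hk]; simp
  rw [unitDiff, map_sub, coordSum_indicator, coordSum_indicator, h, h]

lemma mem_rankHyperplane_iff (hF : F.Finite) {x : α → ℝ} :
    x ∈ M.rankHyperplane F ↔ coordSum hF x = M.rkNat F := by
  rw [coordSum_apply]
  rfl

lemma indicator_mem_rankHyperplane_iff (hF : F.Finite) :
    B.indicator 1 ∈ M.rankHyperplane F ↔ M.IsTight B F := by
  rw [mem_rankHyperplane_iff hF, coordSum_indicator, IsTight]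
  norm_cast

lemma IsBase.indicator_mem_basePolytope (hB : M.IsBase B) :
    B.indicator 1 ∈ M.basePolytope :=
  subset_convexHull ℝ _ ⟨B, hB, rfl⟩

lemma vectorSpan_basePolytope (hB : M.IsBase B) :
    vectorSpan ℝ M.basePolytope =
      Submodule.span ℝ ((· -ᵥ B.indicator (1 : α → ℝ)) ''
        {x | ∃ B, M.IsBase B ∧ x = B.indicator 1}) := by
  rw [basePolytope, ← direction_affineSpan, affineSpan_convexHull, direction_affineSpan]
  exact vectorSpan_eq_span_vsub_set_right ℝ ⟨B, hB, rfl⟩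

/-- A vector supported by `K` with zero sum is a combination of differences of unit vectors. -/
lemma mem_of_coordSum_eq_zero {W : Submodule ℝ (α → ℝ)} (hK : K.Finite)
    (hW : ∀ i ∈ K, ∀ j ∈ K, unitDiff i j ∈ W) {x : α → ℝ} (hx : ∀ e ∉ K, x e = 0)
    (hsum : coordSum hK x = 0) : x ∈ W := by
  classical
  rcases K.eq_empty_or_nonempty with rfl | ⟨k, hk⟩
  · convert W.zero_mem
    funext e
    exact hx e (Set.notMem_empty e)
  have h : x = ∑ e ∈ hK.toFinset, x e • unitDiff e k := by
    simp only [unitDiff, smul_sub, Finset.sum_sub_distrib, ← Finset.sum_smul]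
    have h0 : ∑ e ∈ hK.toFinset, x e = 0 := by
      rw [← hsum]; simp [coordSum]
    rw [h0, zero_smul, sub_zero]
    funext e
    simp only [Finset.sum_apply, Pi.smul_apply, Set.indicator_apply, Set.mem_singleton_iff,
      Pi.one_apply, smul_eq_mul, mul_ite, mul_one, mul_zero, Finset.sum_ite_eq,
      Set.Finite.mem_toFinset]
    split_ifs with he
    · rfl
    · exact hx e he
  rw [h]
  exact W.sum_mem fun e he => W.smul_mem _ (hW e (hK.mem_toFinset.1 he) k hk)

lemma IsTight.exchange (hB : M.IsTight B F) (he : e ∈ B) (hf : f ∉ B)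
    (h : e ∈ F ↔ f ∈ F) : M.IsTight (insert f (B \ {e})) F := by
  unfold IsTight at *
  rw [← hB]
  by_cases heF : e ∈ F
  · have hfF := h.1 heF
    have : insert f (B \ {e}) ∩ F = insert f ((B ∩ F) \ {e}) := by
      ext x
      simp only [Set.mem_inter_iff, Set.mem_insert_iff, Set.mem_sdiff, Set.mem_singleton_iff]
      constructor
      · tauto
      · rintro (rfl | h)
        · exact ⟨Or.inl rfl, hfF⟩
        · tauto
    rw [this, Set.ncard_exchange (fun h : f ∈ B ∩ F => hf h.1) ⟨he, heF⟩]
  · have hfF : f ∉ F := fun h' => heF (h.2 h')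
    congr 1
    ext x
    simp only [Set.mem_inter_iff, Set.mem_insert_iff, Set.mem_sdiff, Set.mem_singleton_iff]
    constructor
    · rintro ⟨rfl | h1, h2⟩
      · exact absurd h2 hfF
      · exact ⟨h1.1, h2⟩
    · rintro ⟨h1, h2⟩
      exact ⟨Or.inr ⟨h1, fun h3 => heF (h3 ▸ h2)⟩, h2⟩

/-- The directions of the face in which the rank condition of `F` is tight. -/
abbrev faceSpan (M : Matroid α) (F : Set α) : Submodule ℝ (α → ℝ) :=
  vectorSpan ℝ (M.basePolytope ∩ M.rankHyperplane F)

lemma coordSum_eq_zero_of_mem_faceSpan (hF : F.Finite) {x : α → ℝ} (hx : x ∈ M.faceSpan F) :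
    coordSum hF x = 0 := by
  have : M.faceSpan F ≤ LinearMap.ker (coordSum hF) := by
    refine Submodule.span_le.2 ?_
    rintro _ ⟨y, hy, z, hz, rfl⟩
    have h1 := (mem_rankHyperplane_iff hF).1 hy.2
    have h2 := (mem_rankHyperplane_iff hF).1 hz.2
    simp [h1, h2]
  exact this hx

lemma IsFlacet.nonempty (hF : M.IsFlacet K F) : F.Nonempty := by
  rw [Set.nonempty_iff_ne_empty]
  rintro rfl
  simpa using hF.lt_ncard

lemma IsFlacet.sdiff_nonempty (hF : M.IsFlacet K F) : (K \ F).Nonempty := by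
  rw [Set.nonempty_iff_ne_empty]
  intro h
  rw [hF.subset.antisymm (Set.sdiff_eq_empty.1 h)] at hF
  exact lt_irrefl _ hF.lt_rkNat

variable [M.Finite]

/-- Exchanges in a connected minor generate all differences of unit vectors. -/
lemma IsMinorConnected.unitDiff_mem (hLU : M.IsMinorConnected L U) (hL : L ⊆ U) (hU : U ⊆ M.E)
    {W : Submodule ℝ (α → ℝ)} (hB : M.IsBase B) (hBL : M.IsTight B L) (hBU : M.IsTight B U)
    (hW : ∀ B, M.IsBase B → M.IsTight B L → M.IsTight B U → ∀ e ∈ B, ∀ f ∉ B, e ∈ U \ L →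
      f ∈ U \ L → M.IsBase (insert f (B \ {e})) → unitDiff f e ∈ W)
    (hi : i ∈ U \ L) (hj : j ∈ U \ L) : unitDiff i j ∈ W := by
  have hBfin := finite_of_subset_ground hB.subset_ground
  -- If L ∪ A were not tight, an exchange inside U would bring an element into it. That element is
  -- not in L, which is already full, so the exchange direction lies in W.
  have key : ∀ A ⊆ U \ L, (∀ e ∈ (U \ L) \ A, ∀ f ∈ A, unitDiff f e ∉ W) →
      M.IsTight B (L ∪ A) := by
    intro A hA hAW
    by_contra hc
    obtain ⟨f, hf, e, he, hbase⟩ := hB.exists_exchange_of_not_isTight hU hBU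
      (Set.union_subset hL (hA.trans Set.sdiff_subset)) hc
    have heL : e ∉ L := fun h => he.2 (Or.inl h)
    have heA : e ∉ A := fun h => he.2 (Or.inr h)
    have hfL : f ∉ L := by
      intro hfL
      have h1 := hbase.indep.ncard_inter_le L
      have h2 : insert f (B ∩ L) ⊆ insert f (B \ {e}) ∩ L := by
        rintro x (rfl | hx)
        · exact ⟨Set.mem_insert _ _, hfL⟩
        · exact ⟨Set.mem_insert_of_mem _ ⟨hx.1, fun h => heL (h ▸ hx.2)⟩, hx.2⟩
      have h3 := Set.ncard_le_ncard h2
        ((finite_of_subset_ground hbase.subset_ground).subset Set.inter_subset_left)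
      rw [Set.ncard_insert_of_notMem (fun h => hf.2 h.1)
        (hBfin.subset Set.inter_subset_left), hBL] at h3
      omega
    have hfA : f ∈ A := hf.1.resolve_left hfL
    exact hAW e ⟨⟨he.1.2, heL⟩, heA⟩ f hfA
      (hW B hB hBL hBU e he.1.1 f hf.2 ⟨he.1.2, heL⟩ (hA hfA) hbase)
  -- The class of j under the relation that the unit difference lies in W. By `key`, both L ∪ A and
  -- U \ A are tight, so A separates the minor and must be all of it.
  set A := {e | e ∈ U \ L ∧ unitDiff e j ∈ W} with hAdef
  have hA : A ⊆ U \ L := fun e he => he.1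
  have hswap : ∀ e f, unitDiff f e ∈ W → unitDiff e f ∈ W := by
    intro e f h
    have := W.neg_mem h
    rwa [unitDiff, neg_sub] at this
  have htrans : ∀ a b c, unitDiff a b ∈ W → unitDiff b c ∈ W → unitDiff a c ∈ W := by
    intro a b c h1 h2
    have := W.add_mem h1 h2
    rwa [unitDiff, unitDiff, sub_add_sub_cancel] at this
  have t1 := key A hA fun e he f hf h => he.2 ⟨he.1, htrans e f j (hswap e f h) hf.2⟩
  have t2 := key ((U \ L) \ A) Set.sdiff_subset fun e he f hf h => by
    rw [Set.sdiff_sdiff_cancel_left hA] at he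
    exact hf.2 ⟨hf.1, htrans f e j h he.2⟩
  have e1 : L ∪ ((U \ L) \ A) = U \ A := by
    ext e
    have h1 : e ∈ L → e ∈ U := @hL e
    have h2 : e ∈ A → e ∈ U \ L := @hA e
    simp only [Set.mem_union, Set.mem_sdiff] at h2 ⊢
    clear * - h1 h2
    tauto
  rw [e1] at t2
  have n1 := ncard_inter_add hBfin (Set.subset_union_left (s := L) (t := A))
  have n2 := ncard_inter_add hBfin (hA.trans Set.sdiff_subset)
  have e2 : (L ∪ A) \ L = A := by
    ext e
    have h2 : e ∈ A → e ∈ U \ L := @hA e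
    simp only [Set.mem_union, Set.mem_sdiff] at h2 ⊢
    clear * - h2
    tauto
  rw [e2] at n1
  unfold IsTight at t1 t2 hBL hBU
  rcases hLU A hA (by omega) with h | h
  · have : j ∈ A := ⟨hj, by rw [unitDiff_self]; exact W.zero_mem⟩
    rw [h] at this
    exact absurd this (Set.notMem_empty j)
  · exact (h ▸ hi : i ∈ A).2

lemma unitDiff_mem_vectorSpan_basePolytope (hK : M.IsRkSeparator K)
    (hKc : M.IsMinorConnected ∅ K) (hi : i ∈ K) (hj : j ∈ K) :
    unitDiff i j ∈ vectorSpan ℝ M.basePolytope := by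
  obtain ⟨B, hB⟩ := M.exists_isBase
  refine hKc.unitDiff_mem (Set.empty_subset K) hK.1 hB (M.isTight_empty B) (hK.isTight hB) ?_
    (by simpa using hi) (by simpa using hj)
  intro B hB _ _ e he f hf _ _ hbase
  rw [← indicator_exchange_sub he hf]
  exact vsub_mem_vectorSpan ℝ hbase.indicator_mem_basePolytope hB.indicator_mem_basePolytope

lemma indicator_sub_mem_faceSpan (hF : F ⊆ M.E) {B B' : Set α} (hB : M.IsBase B)
    (hB' : M.IsBase B') (hBF : M.IsTight B F) (hBF' : M.IsTight B' F) :
    B.indicator 1 - B'.indicator 1 ∈ M.faceSpan F :=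
  vsub_mem_vectorSpan ℝ
    ⟨hB.indicator_mem_basePolytope,
      (indicator_mem_rankHyperplane_iff (finite_of_subset_ground hF)).2 hBF⟩
    ⟨hB'.indicator_mem_basePolytope,
      (indicator_mem_rankHyperplane_iff (finite_of_subset_ground hF)).2 hBF'⟩

namespace IsFlacet

lemma unitDiff_mem (hK : M.IsRkSeparator K) (hF : M.IsFlacet K F) (hi : i ∈ F) (hj : j ∈ F) :
    unitDiff i j ∈ M.faceSpan F := by
  have hFE := hF.subset.trans hK.1
  obtain ⟨B, hB, hBF⟩ := M.exists_isTight hFE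
  refine hF.restrict.unitDiff_mem (Set.empty_subset F) hFE hB (M.isTight_empty B) hBF ?_
    (by simpa using hi) (by simpa using hj)
  intro B hB _ hBF e he f hf heF hfF hbase
  rw [← indicator_exchange_sub he hf]
  exact indicator_sub_mem_faceSpan hFE hbase hB
    (hBF.exchange he hf (by simp [heF.1, hfF.1])) hBF

lemma unitDiff_mem_of_sdiff (hK : M.IsRkSeparator K) (hF : M.IsFlacet K F) (hi : i ∈ K \ F)
    (hj : j ∈ K \ F) : unitDiff i j ∈ M.faceSpan F := by
  have hFE := hF.subset.trans hK.1
  obtain ⟨B, hB, hBF⟩ := M.exists_isTight hFE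
  refine hF.contract.unitDiff_mem hF.subset hK.1 hB hBF (hK.isTight hB) ?_ hi hj
  intro B hB hBF _ e he f hf heF hfF hbase
  rw [← indicator_exchange_sub he hf]
  exact indicator_sub_mem_faceSpan hFE hbase hB
    (hBF.exchange he hf
      (by simp [heF.2, hfF.2])) hBF

/-- The coordinate sum over F vanishes on the face directions and is 1 on one difference from F to K
\ F. This difference and the face directions span all directions of the polytope, so the codimension
is one. -/
lemma isFacetDefining (hK : M.IsRkSeparator K) (hKc : M.IsMinorConnected ∅ K)
    (hF : M.IsFlacet K F) : M.IsFacetDefining F := by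
  have hFE := hF.subset.trans hK.1
  have hFfin := finite_of_subset_ground hFE
  have hKfin := finite_of_subset_ground hK.1
  obtain ⟨B₀, hB₀, hB₀F⟩ := M.exists_isTight hFE
  refine ⟨hFE, ⟨_, hB₀.indicator_mem_basePolytope,
    (indicator_mem_rankHyperplane_iff hFfin).2 hB₀F⟩, ?_⟩
  obtain ⟨i, hi⟩ := hF.nonempty
  obtain ⟨j, hj⟩ := hF.sdiff_nonempty
  -- The type `α` may be infinite; finite dimension comes from the finite number of bases.
  have hfd : FiniteDimensional ℝ (vectorSpan ℝ M.basePolytope) := by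
    rw [basePolytope, ← direction_affineSpan, affineSpan_convexHull, direction_affineSpan]
    refine finiteDimensional_vectorSpan_of_finite ℝ ?_
    refine ((M.ground_finite.finite_subsets).image fun B => B.indicator 1).subset ?_
    rintro _ ⟨B, hB, rfl⟩
    exact ⟨B, hB.subset_ground, rfl⟩
  have hle : M.faceSpan F ≤ vectorSpan ℝ M.basePolytope :=
    vectorSpan_mono ℝ Set.inter_subset_left
  have hfd' : FiniteDimensional ℝ (M.faceSpan F) := Submodule.finiteDimensional_of_le hle
  have hd : unitDiff i j ∈ vectorSpan ℝ M.basePolytope :=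
    unitDiff_mem_vectorSpan_basePolytope hK hKc (hF.subset hi) hj.1
  have hd1 : coordSum hFfin (unitDiff i j) = 1 := by
    classical
    rw [coordSum_unitDiff, if_pos hi, if_neg hj.2, sub_zero]
  have hdis : M.faceSpan F ⊓ Submodule.span ℝ {unitDiff i j} = ⊥ := by
    rw [Submodule.eq_bot_iff]
    rintro x ⟨hx1, hx2⟩
    obtain ⟨c, rfl⟩ := Submodule.mem_span_singleton.1 hx2
    have := coordSum_eq_zero_of_mem_faceSpan hFfin hx1
    rw [map_smul, hd1, smul_eq_mul, mul_one] at this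
    rw [this, zero_smul]
  have hsup : M.faceSpan F ⊔ Submodule.span ℝ {unitDiff i j} = vectorSpan ℝ M.basePolytope := by
    refine le_antisymm (sup_le hle (Submodule.span_le.2 (by simpa using hd))) ?_
    have hdm : unitDiff i j ∈ M.faceSpan F ⊔ Submodule.span ℝ {unitDiff i j} :=
      Submodule.mem_sup_right (Submodule.mem_span_singleton_self _)
    have hcol : ∀ a ∈ K, unitDiff a j ∈ M.faceSpan F ⊔ Submodule.span ℝ {unitDiff i j} := by
      intro a ha
      by_cases haF : a ∈ F
      · have := Submodule.add_mem _ (Submodule.mem_sup_left (hF.unitDiff_mem hK haF hi)) hdm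
        rwa [unitDiff, unitDiff, sub_add_sub_cancel] at this
      · exact Submodule.mem_sup_left (hF.unitDiff_mem_of_sdiff hK ⟨ha, haF⟩ hj)
    have hall : ∀ a ∈ K, ∀ b ∈ K,
        unitDiff a b ∈ M.faceSpan F ⊔ Submodule.span ℝ {unitDiff i j} := by
      intro a ha b hb
      rw [← unitDiff_sub_unitDiff a b j]
      exact Submodule.sub_mem _ (hcol a ha) (hcol b hb)
    rw [vectorSpan_basePolytope hB₀, Submodule.span_le]
    rintro _ ⟨_, ⟨B, hB, rfl⟩, rfl⟩
    have hKt := hK.isTight hB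
    have hKt₀ := hK.isTight hB₀
    have hinK : ∀ {B}, M.IsBase B → M.Indep (B ∩ K) := fun hB =>
      hB.indep.subset Set.inter_subset_left
    have houtK : ∀ {B}, M.IsBase B → M.Indep (B ∩ (M.E \ K)) := fun hB =>
      hB.indep.subset Set.inter_subset_left
    -- The hybrid base agrees with B₀ on K, so it lies in the face; its difference from B is
    -- supported on K and has zero sum there.
    have hB' : M.IsBase (B₀ ∩ K ∪ B ∩ (M.E \ K)) :=
      hK.isBase_union (hinK hB₀) Set.inter_subset_right hKt₀ (houtK hB) Set.inter_subset_right
        (hK.compl.isTight hB)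
    have hB'F : M.IsTight (B₀ ∩ K ∪ B ∩ (M.E \ K)) F := by
      unfold IsTight
      rw [← hB₀F]
      congr 1
      ext x
      have : x ∈ F → x ∈ K := @hF.subset x
      simp only [Set.mem_inter_iff, Set.mem_union, Set.mem_sdiff]
      tauto
    have h1 := indicator_sub_mem_faceSpan hFE hB' hB₀ hB'F hB₀F
    have h2 : B.indicator (1 : α → ℝ) - (B₀ ∩ K ∪ B ∩ (M.E \ K)).indicator 1 ∈
        M.faceSpan F ⊔ Submodule.span ℝ {unitDiff i j} := by
      refine mem_of_coordSum_eq_zero hKfin hall ?_ ?_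
      · intro e he
        classical
        have : e ∈ B → e ∈ M.E := fun h => hB.subset_ground h
        simp only [Pi.sub_apply, Set.indicator_apply, Set.mem_union, Set.mem_inter_iff,
          Set.mem_sdiff, he, and_false, not_false_eq_true, and_true, false_or]
        by_cases heB : e ∈ B
        · simp [heB, this heB]
        · simp [heB]
      · have hKt' := hK.isTight hB'
        unfold IsTight at hKt hKt'
        rw [map_sub, coordSum_indicator, coordSum_indicator, hKt, hKt', sub_self]
    have := Submodule.add_mem _ h2 (Submodule.mem_sup_left h1)
    rwa [sub_add_sub_cancel] at this
  have := Submodule.finrank_sup_add_finrank_inf_eq (M.faceSpan F)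
    (Submodule.span ℝ {unitDiff i j})
  rw [hsup, hdis, finrank_bot, add_zero, finrank_span_singleton (by
    intro h
    rw [h, map_zero] at hd1
    exact zero_ne_one hd1)] at this
  exact this.symm

/-- Different flacets define different facets. -/
lemma eq_of_face_eq (hK : M.IsRkSeparator K) (hKc : M.IsMinorConnected ∅ K)
    (hF : M.IsFlacet K F) (hG : M.IsFlacet K G)
    (h : M.basePolytope ∩ M.rankHyperplane F = M.basePolytope ∩ M.rankHyperplane G) :
    F = G := by
  classical
  have hFfin := finite_of_subset_ground (hF.subset.trans hK.1)
  have hGfin := finite_of_subset_ground (hG.subset.trans hK.1)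
  -- On the common face x(G) is constant, so G cannot separate i from j. Hence G contains or avoids
  -- each of F and K \ F.
  have hG0 : ∀ i j, unitDiff i j ∈ M.faceSpan F → i ∈ G → j ∈ G := by
    intro i j hij hi
    rw [faceSpan, h] at hij
    by_contra hj
    have := coordSum_eq_zero_of_mem_faceSpan hGfin hij
    rw [coordSum_unitDiff, if_pos hi, if_neg hj] at this
    norm_num at this
  have hin : F ⊆ G ∨ Disjoint F G := by
    by_cases hd : Disjoint F G
    · exact Or.inr hd
    · obtain ⟨i, hi, hiG⟩ := Set.not_disjoint_iff.1 hd
      exact Or.inl fun j hj => hG0 i j (hF.unitDiff_mem hK hi hj) hiG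
  have hout : K \ F ⊆ G ∨ Disjoint (K \ F) G := by
    by_cases hd : Disjoint (K \ F) G
    · exact Or.inr hd
    · obtain ⟨i, hi, hiG⟩ := Set.not_disjoint_iff.1 hd
      exact Or.inl fun j hj => hG0 i j (hF.unitDiff_mem_of_sdiff hK hi hj) hiG
  have hGK := hG.subset
  rcases hout with hout | hout
  · exfalso
    rcases hin with hin | hin
    · obtain ⟨x, hxK, hxG⟩ := hG.sdiff_nonempty
      by_cases hxF : x ∈ F
      · exact hxG (hin hxF)
      · exact hxG (hout ⟨hxK, hxF⟩)
    -- A base in the common face is tight on both F and K \ F, so F would separate K.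
    · have hGe : G = K \ F :=
        Set.Subset.antisymm (fun x hx => ⟨hGK hx, fun h => Set.disjoint_left.1 hin h hx⟩) hout
      obtain ⟨B, hB, hBF⟩ := M.exists_isTight (hF.subset.trans hK.1)
      have hBG : B.indicator 1 ∈ M.basePolytope ∩ M.rankHyperplane G := by
        rw [← h]
        exact ⟨hB.indicator_mem_basePolytope, (indicator_mem_rankHyperplane_iff hFfin).2 hBF⟩
      replace hBG := (indicator_mem_rankHyperplane_iff hGfin).1 hBG.2
      have hBK := hK.isTight hB
      have := ncard_inter_add (finite_of_subset_ground hB.subset_ground) hF.subset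
      rw [← hGe, hBF, hBG, hBK, hGe] at this
      rcases isMinorConnected_empty.1 hKc F hF.subset this with h0 | h0
      · exact hF.nonempty.ne_empty h0
      · have := hF.sdiff_nonempty
        rw [h0] at this
        simp at this
  · have hGF : G ⊆ F := fun x hx => by
      by_contra hxF
      exact Set.disjoint_left.1 hout ⟨hGK hx, hxF⟩ hx
    rcases hin with hin | hin
    · exact hin.antisymm hGF
    · obtain ⟨x, hx⟩ := hG.nonempty
      exact absurd hx (Set.disjoint_left.1 hin (hGF hx))

end IsFlacet

end Matroid

end

/-! ### Compatible facets of split matroids -/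

noncomputable section

namespace Matroid

variable {α : Type*} {M : Matroid α} {A B B₁ B₂ D F G K L U X Y : Set α} {e f i j : α}

/-- Masses of the four atoms of two sets `F` and `G`, of total mass `r`, with mass `p` in `F` and
mass `q` in `G`, that are strictly between `0` and the sizes of the atoms, as densities. -/
lemma exists_atom_densities {n₁ n₂ n₃ n₄ p q r : ℝ} (h₁ : 0 ≤ n₁) (h₂ : 0 ≤ n₂) (h₃ : 0 ≤ n₃)
    (h₄ : 0 ≤ n₄) (hp : 0 < p) (hp' : p < n₁ + n₂) (hq : 0 < q) (hq' : q < n₁ + n₃)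
    (hpr : p < r) (hpr' : r - p < n₃ + n₄) (hqr : q < r) (hqr' : r - q < n₂ + n₄)
    (k₁ : p + q < n₁ + r) (k₂ : p - q < n₂) (k₃ : q - p < n₃) (k₄ : r < n₄ + p + q) :
    ∃ a₁ a₂ a₃ a₄ : ℝ, ((0 < a₁ ∧ a₁ < 1) ∧ (0 < a₂ ∧ a₂ < 1) ∧ (0 < a₃ ∧ a₃ < 1) ∧
      (0 < a₄ ∧ a₄ < 1)) ∧ n₁ * a₁ + n₂ * a₂ = p ∧ n₁ * a₁ + n₃ * a₃ = q ∧
      n₁ * a₁ + n₂ * a₂ + n₃ * a₃ + n₄ * a₄ = r := by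
  have density : ∀ n y : ℝ, (0 < y ∧ y < n) ∨ (y = 0 ∧ n = 0) →
      ∃ a : ℝ, (0 < a ∧ a < 1) ∧ n * a = y := by
    rintro n y (⟨h, h'⟩ | ⟨rfl, rfl⟩)
    · have hn : 0 < n := h.trans h'
      exact ⟨y / n, ⟨div_pos h hn, (div_lt_one hn).2 h'⟩, mul_div_cancel₀ y hn.ne'⟩
    · exact ⟨1 / 2, by norm_num, by norm_num⟩
  -- The mass z of F ∩ G determines the other three. An empty atom must have mass 0, which fixes z;
  -- otherwise z ranges over an open interval.
  obtain ⟨z, z₁, z₂, z₃, z₄⟩ : ∃ z : ℝ, ((0 < z ∧ z < n₁) ∨ (z = 0 ∧ n₁ = 0)) ∧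
      ((0 < p - z ∧ p - z < n₂) ∨ (p - z = 0 ∧ n₂ = 0)) ∧
      ((0 < q - z ∧ q - z < n₃) ∨ (q - z = 0 ∧ n₃ = 0)) ∧
      ((0 < r - p - q + z ∧ r - p - q + z < n₄) ∨ (r - p - q + z = 0 ∧ n₄ = 0)) := by
    rcases h₁.eq_or_lt with rfl | h₁
    · exact ⟨0, Or.inr ⟨rfl, rfl⟩, Or.inl ⟨by linarith, by linarith⟩,
        Or.inl ⟨by linarith, by linarith⟩, Or.inl ⟨by linarith, by linarith⟩⟩
    rcases h₂.eq_or_lt with rfl | h₂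
    · exact ⟨p, Or.inl ⟨hp, by linarith⟩, Or.inr ⟨by linarith, rfl⟩,
        Or.inl ⟨by linarith, by linarith⟩, Or.inl ⟨by linarith, by linarith⟩⟩
    rcases h₃.eq_or_lt with rfl | h₃
    · exact ⟨q, Or.inl ⟨hq, by linarith⟩, Or.inl ⟨by linarith, by linarith⟩,
        Or.inr ⟨by linarith, rfl⟩, Or.inl ⟨by linarith, by linarith⟩⟩
    rcases h₄.eq_or_lt with rfl | h₄
    · exact ⟨p + q - r, Or.inl ⟨by linarith, by linarith⟩, Or.inl ⟨by linarith, by linarith⟩,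
        Or.inl ⟨by linarith, by linarith⟩, Or.inr ⟨by linarith, rfl⟩⟩
    obtain ⟨z, hz, hz'⟩ : ∃ z, max (max 0 (p - n₂)) (max (q - n₃) (p + q - r)) < z ∧
        z < min (min n₁ p) (min q (n₄ - r + p + q)) := by
      refine exists_between ?_
      simp only [max_lt_iff, lt_min_iff]
      refine ⟨⟨⟨⟨?_, ?_⟩, ?_, ?_⟩, ⟨?_, ?_⟩, ?_, ?_⟩, ⟨⟨?_, ?_⟩, ?_, ?_⟩, ⟨?_, ?_⟩, ?_, ?_⟩ <;>
        linarith
    simp only [max_lt_iff, lt_min_iff] at hz hz'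
    obtain ⟨⟨u₁, u₂⟩, u₃, u₄⟩ := hz
    obtain ⟨⟨v₁, v₂⟩, v₃, v₄⟩ := hz'
    exact ⟨z, Or.inl ⟨u₁, v₁⟩, Or.inl ⟨by linarith, by linarith⟩,
      Or.inl ⟨by linarith, by linarith⟩, Or.inl ⟨by linarith, by linarith⟩⟩
  obtain ⟨a₁, ha₁, e₁⟩ := density _ _ z₁
  obtain ⟨a₂, ha₂, e₂⟩ := density _ _ z₂
  obtain ⟨a₃, ha₃, e₃⟩ := density _ _ z₃
  obtain ⟨a₄, ha₄, e₄⟩ := density _ _ z₄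
  exact ⟨a₁, a₂, a₃, a₄, ⟨ha₁, ha₂, ha₃, ha₄⟩, by linarith, by linarith, by linarith⟩

lemma coordSum_of_forall_eq (hF : F.Finite) {x : α → ℝ} {c : ℝ} (h : ∀ e ∈ F, x e = c) :
    coordSum hF x = F.ncard * c := by
  rw [Set.ncard_eq_toFinset_card F hF]
  simp only [coordSum, LinearMap.coe_sum, Finset.sum_apply, LinearMap.proj_apply]
  rw [Finset.sum_congr rfl fun e he => h e (hF.mem_toFinset.1 he)]
  simp

lemma coordSum_union (hF : F.Finite) (hX : X.Finite) (hY : Y.Finite) (hd : Disjoint X Y)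
    (h : X ∪ Y = F) (x : α → ℝ) : coordSum hF x = coordSum hX x + coordSum hY x := by
  subst h
  rw [coordSum_apply, coordSum_apply, coordSum_apply, finsum_mem_union hd hX hY]

variable [M.Finite]

/-- The ambient polytope contains a neighbourhood, in the affine span of the base polytope, of
each point with fractional coordinates. -/
lemma mem_intrinsicInterior_ambientPolytope {x : α → ℝ}
    (hx : x ∈ affineSpan ℝ M.basePolytope) (h : ∀ e ∈ M.E, 0 < x e ∧ x e < 1) :
    x ∈ intrinsicInterior ℝ M.ambientPolytope := by
  obtain ⟨B, hB⟩ := M.exists_isBase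
  have hBP := subset_affineSpan ℝ _ hB.indicator_mem_basePolytope
  have hzero : ∀ e ∉ M.E, ∀ C, M.IsBase C → C.indicator (1 : α → ℝ) e = 0 := fun e he C hC =>
    Set.indicator_of_notMem (fun h => he (hC.subset_ground h)) _
  -- A linear functional that is constant on the bases is constant on their affine span. This yields
  -- the equations of the hypersimplex.
  have hspan : ∀ φ : (α → ℝ) →ₗ[ℝ] ℝ, ∀ c : ℝ, (∀ C, M.IsBase C → φ (C.indicator 1) = c) →
      ∀ y ∈ affineSpan ℝ M.basePolytope, φ y = c := by
    intro φ c hφ y hy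
    have h1 := AffineSubspace.vsub_mem_direction hy hBP
    rw [direction_affineSpan, vectorSpan_basePolytope hB] at h1
    have h2 : Submodule.span ℝ ((· -ᵥ B.indicator (1 : α → ℝ)) ''
        {x | ∃ B, M.IsBase B ∧ x = B.indicator 1}) ≤ LinearMap.ker φ := by
      refine Submodule.span_le.2 ?_
      rintro _ ⟨_, ⟨C, hC, rfl⟩, rfl⟩
      simp [hφ C hC, hφ B hB]
    have h3 : φ (y - B.indicator 1) = 0 := h2 h1
    rw [map_sub, hφ B hB] at h3
    linarith
  have hmem : ∀ y ∈ affineSpan ℝ M.basePolytope, (∀ e ∈ M.E, 0 < y e ∧ y e < 1) →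
      y ∈ M.ambientPolytope := by
    intro y hy h
    refine ⟨hy, fun e he => ⟨(h e he).1.le, (h e he).2.le⟩, fun e he => ?_, ?_⟩
    · exact hspan (LinearMap.proj e) 0 (fun C hC => hzero e he C hC) y hy
    · rw [← coordSum_apply M.ground_finite]
      refine hspan _ _ (fun C hC => ?_) y hy
      rw [coordSum_indicator, Set.inter_eq_left.2 hC.subset_ground, hC.ncard_eq]
  have hxQ := hmem x hx h
  rw [mem_intrinsicInterior]
  refine ⟨⟨x, subset_affineSpan ℝ _ hxQ⟩, ?_, rfl⟩
  rw [mem_interior]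
  refine ⟨{y | ∀ e ∈ M.E, 0 < (y : α → ℝ) e ∧ (y : α → ℝ) e < 1}, ?_, ?_, h⟩
  · intro y hy
    refine hmem y ?_ hy
    have hle : affineSpan ℝ M.ambientPolytope ≤ affineSpan ℝ M.basePolytope :=
      affineSpan_le.2 fun z hz => hz.1
    exact hle y.2
  · have : {y : affineSpan ℝ M.ambientPolytope |
        ∀ e ∈ M.E, 0 < (y : α → ℝ) e ∧ (y : α → ℝ) e < 1} =
        ⋂ e ∈ M.E, {y : affineSpan ℝ M.ambientPolytope |
          0 < (y : α → ℝ) e ∧ (y : α → ℝ) e < 1} := by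
      ext; simp
    rw [this]
    refine M.ground_finite.isOpen_biInter fun e _ => ?_
    have hc : Continuous fun y : affineSpan ℝ M.ambientPolytope => (y : α → ℝ) e :=
      (continuous_apply e).comp continuous_subtype_val
    exact (isOpen_lt continuous_const hc).inter (isOpen_lt hc continuous_const)

/-- Two bases that partition the ground set. -/
structure IsBasePartition (M : Matroid α) (B₁ B₂ : Set α) : Prop where
  left : M.IsBase B₁
  right : M.IsBase B₂
  disjoint : Disjoint B₁ B₂
  union : B₁ ∪ B₂ = M.E

lemma IsBasePartition.ncard_le (h : M.IsBasePartition B₁ B₂) (hA : A ⊆ M.E) :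
    A.ncard ≤ 2 * M.rkNat A := by
  have h1 := h.left.indep.ncard_inter_le A
  have h2 := h.right.indep.ncard_inter_le A
  have h3 := Set.ncard_union_le (B₁ ∩ A) (B₂ ∩ A)
  rw [← Set.union_inter_distrib_right, h.union, Set.inter_eq_right.2 hA] at h3
  omega

lemma IsBasePartition.ncard_eq (h : M.IsBasePartition B₁ B₂) (hK : M.IsRkSeparator K) :
    K.ncard = 2 * M.rkNat K := by
  have h1 := hK.isTight h.left
  have h2 := hK.isTight h.right
  have h3 := Set.ncard_union_eq (h.disjoint.mono Set.inter_subset_left Set.inter_subset_left :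
      Disjoint (B₁ ∩ K) (B₂ ∩ K))
    ((finite_of_subset_ground hK.1).subset Set.inter_subset_right)
    ((finite_of_subset_ground hK.1).subset Set.inter_subset_right)
  rw [← Set.union_inter_distrib_right, h.union, Set.inter_eq_right.2 hK.1, h1, h2] at h3
  omega

namespace IsFlacet

lemma rkNat_pos (hP : M.IsBasePartition B₁ B₂) (hK : M.IsRkSeparator K) (hF : M.IsFlacet K F) :
    0 < M.rkNat F := by
  have h1 := hP.ncard_le (hF.subset.trans hK.1)
  have h2 := hF.lt_ncard
  omega

/-- Otherwise F ∩ G separates F. It is not empty, because r(G) > 0; so F ⊆ G with equal ranks, and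
then G \ F splits off in the contraction of F, against connectedness. -/
lemma rkNat_lt_add_ncard_sdiff (hP : M.IsBasePartition B₁ B₂) (hK : M.IsRkSeparator K)
    (hF : M.IsFlacet K F) (hG : M.IsFlacet K G) (hne : F ≠ G) :
    M.rkNat F < M.rkNat G + (F \ G).ncard := by
  by_contra! hc
  have h1 := M.rkNat_le_add_sdiff (Set.inter_subset_left (s := F) (t := G))
  rw [Set.sdiff_self_inter] at h1
  have h2 := rkNat_le_ncard (M := M) (X := F \ G)
    (Set.sdiff_subset.trans (hF.subset.trans hK.1))
  have h3 := rkNat_mono (M := M) (Set.inter_subset_right (s := F) (t := G))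
  have h4 := hG.rkNat_pos hP hK
  rcases isMinorConnected_empty.1 hF.restrict (F ∩ G) Set.inter_subset_left
    (by rw [Set.sdiff_self_inter]; omega) with h | h
  · rw [h, rkNat_empty] at h3 h1
    omega
  · have hFG : F ⊆ G := Set.inter_eq_left.1 h
    have h5 := rkNat_mono (M := M) hFG
    have h6 := M.rkNat_inter_add_rkNat_union_le G (K \ (G \ F))
    have e1 : G ∩ (K \ (G \ F)) = F := by
      ext e
      have : e ∈ F → e ∈ G := @hFG e
      have : e ∈ F → e ∈ K := @hF.subset e
      simp only [Set.mem_inter_iff, Set.mem_sdiff]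
      tauto
    have e2 : G ∪ (K \ (G \ F)) = K := by
      ext e
      have : e ∈ G → e ∈ K := @hG.subset e
      simp only [Set.mem_union, Set.mem_sdiff]
      tauto
    rw [e1, e2] at h6
    have h7 := rkNat_mono (M := M) (Set.sdiff_subset (s := K) (t := G \ F))
    rcases hF.contract (G \ F) (Set.sdiff_subset_sdiff_left hG.subset) (by
      rw [Set.union_sdiff_cancel hFG]; omega) with h8 | h8
    · exact hne (hFG.antisymm (Set.sdiff_eq_empty.1 h8))
    · obtain ⟨x, hxK, hxG⟩ := hG.sdiff_nonempty
      have : x ∈ G \ F := h8 ▸ ⟨hxK, fun h => hxG (hFG h)⟩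
      exact hxG this.1

/-- K \ F is covered by G and K \ (F ∪ G), so in case of failure r(F) + r(K \ F) ≤ r(K) and F
separates K. -/
lemma rkNat_lt_add_ncard (hK : M.IsRkSeparator K) (hKc : M.IsMinorConnected ∅ K)
    (hF : M.IsFlacet K F) (G : Set α) :
    M.rkNat K < (K \ (F ∪ G)).ncard + M.rkNat F + M.rkNat G := by
  by_contra! hc
  have h1 := M.rkNat_le_add_sdiff hF.subset
  have h2 := M.rkNat_inter_add_rkNat_union_le G (K \ (F ∪ G))
  have h3 := rkNat_le_ncard (M := M) (X := K \ (F ∪ G)) (Set.sdiff_subset.trans hK.1)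
  have h4 : M.rkNat (K \ F) ≤ M.rkNat (G ∪ K \ (F ∪ G)) := by
    refine rkNat_mono fun e he => ?_
    by_cases heG : e ∈ G
    · exact Or.inl heG
    · exact Or.inr ⟨he.1, fun h => h.elim he.2 heG⟩
  rcases isMinorConnected_empty.1 hKc F hF.subset (by omega) with h | h
  · exact hF.nonempty.ne_empty h
  · exact absurd hF.lt_rkNat (by rw [h]; exact lt_irrefl _)

end IsFlacet

/-- A point of the affine span of the base polytope is obtained by redistributing the coordinates
of the centre within a connected component. -/
lemma IsBasePartition.mem_affineSpan (hP : M.IsBasePartition B₁ B₂) (hK : M.IsRkSeparator K)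
    (hKc : M.IsMinorConnected ∅ K) {x : α → ℝ} (hx : ∀ e ∈ M.E \ K, x e = 1 / 2)
    (hx' : ∀ e ∉ M.E, x e = 0)
    (hsum : coordSum (finite_of_subset_ground hK.1) x = M.rkNat K) :
    x ∈ affineSpan ℝ M.basePolytope := by
  -- The centre is the midpoint of the two bases of the partition.
  have hc : M.E.indicator (fun _ => (1 / 2 : ℝ)) ∈ M.basePolytope := by
    have h := (convex_convexHull ℝ {x : α → ℝ | ∃ B, M.IsBase B ∧ x = B.indicator 1})
      hP.left.indicator_mem_basePolytope hP.right.indicator_mem_basePolytope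
      (by norm_num : (0 : ℝ) ≤ 1 / 2) (by norm_num : (0 : ℝ) ≤ 1 / 2) (by norm_num)
    convert! h using 1
    funext e
    rw [← hP.union]
    by_cases h1 : e ∈ B₁
    · have h2 := Set.disjoint_left.1 hP.disjoint h1
      simp [h1, h2]
    · by_cases h2 : e ∈ B₂ <;> simp [h1, h2]
  have hd : x - M.E.indicator (fun _ => (1 / 2 : ℝ)) ∈ vectorSpan ℝ M.basePolytope := by
    refine mem_of_coordSum_eq_zero (finite_of_subset_ground hK.1)
      (fun i hi j hj => unitDiff_mem_vectorSpan_basePolytope hK hKc hi hj) ?_ ?_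
    · intro e he
      by_cases heE : e ∈ M.E
      · simp [hx e ⟨heE, he⟩, heE]
      · simp [hx' e heE, heE]
    · rw [map_sub, hsum, coordSum_of_forall_eq (c := 1 / 2) _ fun e he => by simp [hK.1 he],
        hP.ncard_eq hK]
      push_cast
      ring
  have := AffineSubspace.vadd_mem_of_mem_direction (s := affineSpan ℝ M.basePolytope)
    (by rwa [direction_affineSpan]) (subset_affineSpan ℝ _ hc)
  rwa [vadd_eq_add, sub_add_cancel] at this

/-- Compatibility of the facets of a split matroid in terms of ranks and cardinalities. -/
theorem IsSplit.ncard_inter_add_rkNat_le (hM : M.IsSplit) (hP : M.IsBasePartition B₁ B₂)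
    (hK : M.IsRkSeparator K) (hKc : M.IsMinorConnected ∅ K) (hF : M.IsFlacet K F)
    (hG : M.IsFlacet K G) (hne : F ≠ G) :
    (F ∩ G).ncard + M.rkNat K ≤ M.rkNat F + M.rkNat G := by
  classical
  -- The negated inequality is the one atom condition that is not automatic for flacets.
  by_contra! hc
  have hKfin := finite_of_subset_ground hK.1
  have hFfin := hKfin.subset hF.subset
  have hGfin := hKfin.subset hG.subset
  have h1fin : (F ∩ G).Finite := hFfin.subset Set.inter_subset_left
  have h2fin : (F \ G).Finite := hFfin.subset Set.sdiff_subset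
  have h3fin : (G \ F).Finite := hGfin.subset Set.sdiff_subset
  have h4fin : (K \ (F ∪ G)).Finite := hKfin.subset Set.sdiff_subset
  have hKFfin : (K \ F).Finite := hKfin.subset Set.sdiff_subset
  have u1 : F ∩ G ∪ F \ G = F := Set.inter_union_sdiff F G
  have u2 : F ∩ G ∪ G \ F = G := by rw [Set.inter_comm]; exact Set.inter_union_sdiff G F
  have u3 : G \ F ∪ K \ (F ∪ G) = K \ F := by
    ext e
    have : e ∈ G → e ∈ K := @hG.subset e
    simp only [Set.mem_union, Set.mem_sdiff]
    tauto
  have u4 : F ∪ K \ F = K := Set.union_sdiff_cancel hF.subset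
  have d1 : Disjoint (F ∩ G) (F \ G) := Set.disjoint_left.2 fun e h h' => h'.2 h.2
  have d2 : Disjoint (F ∩ G) (G \ F) := Set.disjoint_left.2 fun e h h' => h'.2 h.1
  have d3 : Disjoint (G \ F) (K \ (F ∪ G)) :=
    Set.disjoint_left.2 fun e h h' => h'.2 (Or.inr h.1)
  have d4 : Disjoint F (K \ F) := Set.disjoint_sdiff_right
  have c1 := Set.ncard_union_eq d1 h1fin h2fin
  have c2 := Set.ncard_union_eq d2 h1fin h3fin
  have c3 := Set.ncard_union_eq d3 h3fin h4fin
  have c4 := Set.ncard_union_eq d4 hFfin hKFfin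
  rw [u1] at c1
  rw [u2] at c2
  rw [u3] at c3
  rw [u4] at c4
  -- From |K| = 2r(K), |F| ≤ 2r(F) and r(F) < r(K) it follows that |K \ F| > r(K) - r(F), and
  -- likewise for G.
  have b1 := hP.ncard_le (hF.subset.trans hK.1)
  have b2 := hP.ncard_le (hG.subset.trans hK.1)
  have b3 := hP.ncard_eq hK
  have f1 := hF.lt_ncard
  have f2 := hF.lt_rkNat
  have g1 := hG.lt_ncard
  have g2 := hG.lt_rkNat
  have k1 := hF.rkNat_lt_add_ncard_sdiff hP hK hG hne
  have k2 := hG.rkNat_lt_add_ncard_sdiff hP hK hF hne.symm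
  have k3 := hF.rkNat_lt_add_ncard hK hKc G
  have cast_lt : ∀ {a b : ℕ}, a < b → (a : ℝ) < b := fun h => by exact_mod_cast h
  obtain ⟨a₁, a₂, a₃, a₄, ⟨ha₁, ha₂, ha₃, ha₄⟩, s₁, s₂, s₃⟩ := exists_atom_densities
    (n₁ := (F ∩ G).ncard) (n₂ := (F \ G).ncard) (n₃ := (G \ F).ncard)
    (n₄ := (K \ (F ∪ G)).ncard) (p := M.rkNat F) (q := M.rkNat G) (r := M.rkNat K)
    (Nat.cast_nonneg _) (Nat.cast_nonneg _) (Nat.cast_nonneg _) (Nat.cast_nonneg _)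
    (by exact_mod_cast hF.rkNat_pos hP hK) (by rw [c1] at f1; exact_mod_cast f1)
    (by exact_mod_cast hG.rkNat_pos hP hK) (by rw [c2] at g1; exact_mod_cast g1)
    (cast_lt f2)
    (by
      have := cast_lt (by omega :
        M.rkNat K < (G \ F).ncard + (K \ (F ∪ G)).ncard + M.rkNat F)
      push_cast at this
      linarith)
    (cast_lt g2)
    (by
      have := cast_lt (by omega :
        M.rkNat K < (F \ G).ncard + (K \ (F ∪ G)).ncard + M.rkNat G)
      push_cast at this
      linarith)
    (by exact_mod_cast hc)
    (by
      have := cast_lt k1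
      push_cast at this
      linarith)
    (by
      have := cast_lt k2
      push_cast at this
      linarith)
    (by exact_mod_cast k3)
  set x : α → ℝ := fun e => if e ∈ M.E then
    (if e ∈ K then
      (if e ∈ F then (if e ∈ G then a₁ else a₂) else (if e ∈ G then a₃ else a₄))
      else 1 / 2) else 0 with hxdef
  have hFK : ∀ e ∈ F, e ∈ K ∧ e ∈ M.E := fun e he => ⟨hF.subset he, hK.1 (hF.subset he)⟩
  have hGK : ∀ e ∈ G, e ∈ K ∧ e ∈ M.E := fun e he => ⟨hG.subset he, hK.1 (hG.subset he)⟩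
  have x1 : coordSum h1fin x = (F ∩ G).ncard * a₁ :=
    coordSum_of_forall_eq _ fun e he => by simp [hxdef, hFK e he.1, he.1, he.2]
  have x2 : coordSum h2fin x = (F \ G).ncard * a₂ :=
    coordSum_of_forall_eq _ fun e he => by simp [hxdef, hFK e he.1, he.1, he.2]
  have x3 : coordSum h3fin x = (G \ F).ncard * a₃ :=
    coordSum_of_forall_eq _ fun e he => by simp [hxdef, hGK e he.1, he.1, he.2]
  have x4 : coordSum h4fin x = (K \ (F ∪ G)).ncard * a₄ :=
    coordSum_of_forall_eq _ fun e he => by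
      have h1 : e ∉ F := fun h => he.2 (Or.inl h)
      have h2 : e ∉ G := fun h => he.2 (Or.inr h)
      simp [hxdef, hK.1 he.1, he.1, h1, h2]
  have xF : coordSum hFfin x = M.rkNat F := by
    rw [coordSum_union hFfin h1fin h2fin d1 u1, x1, x2, s₁]
  have xG : coordSum hGfin x = M.rkNat G := by
    rw [coordSum_union hGfin h1fin h3fin d2 u2, x1, x3, s₂]
  have xK : coordSum hKfin x = M.rkNat K := by
    rw [coordSum_union hKfin hFfin hKFfin d4 u4, coordSum_union hKFfin h3fin h4fin d3 u3, xF, x3,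
      x4, ← s₁, ← s₃]
    ring
  have hxint : x ∈ intrinsicInterior ℝ M.ambientPolytope := by
    refine mem_intrinsicInterior_ambientPolytope (hP.mem_affineSpan hK hKc ?_ ?_ xK) ?_
    · intro e he
      simp [hxdef, he.1, he.2]
    · intro e he
      simp [hxdef, he]
    · intro e he
      simp only [hxdef, he, if_true]
      split_ifs
      exacts [ha₁, ha₂, ha₃, ha₄, by norm_num]
  have hxF := (mem_rankHyperplane_iff (M := M) hFfin).2 xF
  have hxG := (mem_rankHyperplane_iff (M := M) hGfin).2 xG
  have := hM F G ⟨hF.isFacetDefining hK hKc, x, hxF, hxint⟩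
    ⟨hG.isFacetDefining hK hKc, x, hxG, hxint⟩ fun h => hne (hF.eq_of_face_eq hK hKc hG h)
  exact Set.notMem_empty x (this ▸ ⟨⟨hxF, hxG⟩, hxint⟩)

end Matroid

end

/-! ### Equitability -/

namespace SignVector

variable {α : Type*}

lemma IsSign.ncard_inter {v : α → ℤ} (hv : IsSign v) {K : Set α} {A : Finset α}
    (hA : (A : Set α) ⊆ K) :
    2 * (({e | e ∈ K ∧ v e = 1} ∩ (A : Set α)).ncard : ℤ) = A.card + ∑ e ∈ A, v e := by
  classical
  have h : ({e | e ∈ K ∧ v e = 1} ∩ (A : Set α)) = ↑(A.filter fun e => v e = 1) := by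
    ext e
    have : e ∈ A → e ∈ K := @hA e
    simp only [Set.mem_inter_iff, Set.mem_ofPred_eq, Finset.mem_coe, Finset.mem_filter]
    tauto
  have h' : ∀ e, v e = 2 * (if v e = 1 then 1 else 0) - 1 := by
    intro e
    rcases hv e with h | h <;> simp [h]
  rw [h, Set.ncard_coe_finset, Finset.sum_congr rfl fun e _ => h' e]
  rw [Finset.sum_sub_distrib, ← Finset.mul_sum, Finset.sum_boole]
  simp

end SignVector

namespace Matroid

open SignVector

variable {α : Type*} {M : Matroid α} {B₁ B₂ K K₁ K₂ X : Set α} [M.Finite]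

/-- The restriction to the separator `K` is equitable. -/
def IsEquitableOn (M : Matroid α) (K : Set α) : Prop :=
  ∀ X ⊆ K, ∃ B ⊆ K, M.Indep B ∧ M.Indep (K \ B) ∧ B.ncard = M.rkNat K ∧
    (K \ B).ncard = M.rkNat K ∧ X.ncard ≤ 2 * (B ∩ X).ncard + 1 ∧
    2 * (B ∩ X).ncard ≤ X.ncard + 1

/-- Flacets of a connected component of a split matroid, with the slacks of the rank conditions on
a basis and its complement. -/
lemma IsSplit.isSlackFamily [DecidableEq α] (hM : M.IsSplit) (hP : M.IsBasePartition B₁ B₂)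
    {K : Finset α} (hK : M.IsRkSeparator K) (hKc : M.IsMinorConnected ∅ (K : Set α)) :
    IsSlackFamily K {F | M.IsFlacet K (F : Set α)} fun F => 2 * M.rkNat F - F.card := by
  refine ⟨fun F hF => Finset.coe_subset.1 hF.subset, fun F hF => ?_, fun F _ => ?_,
    fun F hF G hG hne => ?_⟩
  · have := hP.ncard_le (hF.subset.trans hK.1)
    rw [Set.ncard_coe_finset] at this
    omega
  · omega
  · have h1 := hM.ncard_inter_add_rkNat_le hP hK hKc hF hG fun h => hne (Finset.coe_injective h)
    have h2 := hP.ncard_eq hK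
    rw [← Finset.coe_inter, Set.ncard_coe_finset] at h1
    rw [Set.ncard_coe_finset] at h2
    have h3 := Finset.card_union_add_card_inter F G
    have h4 := Finset.card_sdiff_add_card_eq_card
      (Finset.union_subset (Finset.coe_subset.1 hF.subset) (Finset.coe_subset.1 hG.subset))
    omega

/-- The positive part has r(K) elements since v(K) = 0 and |K| = 2r(K). The bounds are its rank
conditions on flacets, and a dependent set would violate one of them. -/
lemma indep_of_isBalanced [DecidableEq α] (hP : M.IsBasePartition B₁ B₂) {K X : Finset α}
    (hK : M.IsRkSeparator K) (hKc : M.IsMinorConnected ∅ (K : Set α)) (hX : X ⊆ K)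
    {v : α → ℤ} (hv : IsBalanced K X v)
    (h : ∀ F : Finset α, M.IsFlacet K (F : Set α) → ∑ e ∈ F, v e ≤ 2 * M.rkNat F - F.card) :
    M.Indep {e | e ∈ (K : Set α) ∧ v e = 1} ∧
      {e | e ∈ (K : Set α) ∧ v e = 1}.ncard = M.rkNat K := by
  have hsub : {e | e ∈ (K : Set α) ∧ v e = 1} ⊆ K := fun e he => he.1
  have hcard : {e | e ∈ (K : Set α) ∧ v e = 1}.ncard = M.rkNat K := by
    have h1 := hv.isSign.ncard_inter (Set.Subset.refl (K : Set α))
    rw [Set.inter_eq_left.2 hsub, hv.sum_ground hX] at h1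
    have h2 := hP.ncard_eq hK
    rw [Set.ncard_coe_finset] at h2
    omega
  refine ⟨?_, hcard⟩
  by_contra hc
  obtain ⟨F, hF, hlt⟩ := exists_isFlacet hKc hK.1 hsub hcard hc
  lift F to Finset α using (K.finite_toSet.subset hF.subset)
  have h1 := hv.isSign.ncard_inter hF.subset
  have h2 := h F hF
  omega

lemma IsSplit.exists_halving (hM : M.IsSplit) (hP : M.IsBasePartition B₁ B₂)
    (hK : M.IsRkSeparator K) (hKc : M.IsMinorConnected ∅ K) (hX : X ⊆ K) (hXe : Even X.ncard) :
    ∃ B ⊆ K, M.Indep B ∧ M.Indep (K \ B) ∧ B.ncard = M.rkNat K ∧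
      (K \ B).ncard = M.rkNat K ∧ 2 * (B ∩ X).ncard = X.ncard := by
  classical
  have hKe := hP.ncard_eq hK
  lift K to Finset α using finite_of_subset_ground hK.1
  lift X to Finset α using K.finite_toSet.subset hX
  rw [Set.ncard_coe_finset] at hXe hKe
  have hXK := Finset.coe_subset.1 hX
  have hKX : Even (K \ X).card := by
    have h1 := Finset.card_sdiff_add_card_eq_card hXK
    rw [Nat.even_iff] at hXe ⊢
    omega
  obtain ⟨v, hv, hgood⟩ := (hM.isSlackFamily hP hK hKc).exists_balanced hXK hXe hKX
  have hpos := indep_of_isBalanced hP hK hKc hXK hv fun F hF => (abs_le.1 (hgood F hF)).2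
  have hneg := indep_of_isBalanced hP hK hKc hXK hv.neg fun F hF => by
    have := (abs_le.1 (hgood F hF)).1
    simp only [Pi.neg_apply, Finset.sum_neg_distrib]
    linarith
  have hcompl : (K : Set α) \ {e | e ∈ (K : Set α) ∧ v e = 1} =
      {e | e ∈ (K : Set α) ∧ (-v) e = 1} := by
    ext e
    simp only [Set.mem_sdiff, Set.mem_ofPred_eq, Pi.neg_apply]
    rcases hv.isSign e with h | h <;> simp [h]
  refine ⟨_, fun e he => he.1, hpos.1, ?_, hpos.2, ?_, ?_⟩
  · rw [hcompl]; exact hneg.1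
  · rw [hcompl]; exact hneg.2
  · have h1 := hv.isSign.ncard_inter hX
    rw [hv.sum_left] at h1
    rw [Set.ncard_coe_finset]
    omega

lemma IsSplit.isEquitableOn_of_isMinorConnected (hM : M.IsSplit) (hP : M.IsBasePartition B₁ B₂)
    (hK : M.IsRkSeparator K) (hKc : M.IsMinorConnected ∅ K) : M.IsEquitableOn K := by
  intro X hX
  have hKfin := finite_of_subset_ground hK.1
  have hXfin := hKfin.subset hX
  rcases Nat.even_or_odd X.ncard with hXe | hXo
  · obtain ⟨B, hBK, h1, h2, h3, h4, h5⟩ := hM.exists_halving hP hK hKc hX hXe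
    exact ⟨B, hBK, h1, h2, h3, h4, by omega, by omega⟩
  -- K has even size, so an odd X leaves an element of K to add; halving the enlarged set halves X
  -- up to rounding.
  · obtain ⟨x, hxK, hxX⟩ : ∃ x ∈ K, x ∉ X := by
      by_contra! hc
      rw [hX.antisymm hc, hP.ncard_eq hK, Nat.odd_iff] at hXo
      omega
    have hcard := Set.ncard_insert_of_notMem hxX hXfin
    obtain ⟨B, hBK, h1, h2, h3, h4, h5⟩ := hM.exists_halving hP hK hKc
      (Set.insert_subset hxK hX) (by rw [hcard]; exact hXo.add_one)
    have hBX : (B ∩ X).Finite := hXfin.subset Set.inter_subset_right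
    have h6 : (B ∩ X).ncard ≤ (B ∩ insert x X).ncard :=
      Set.ncard_le_ncard (Set.inter_subset_inter_right _ (Set.subset_insert x X))
        ((hXfin.insert x).subset Set.inter_subset_right)
    have h7 : (B ∩ insert x X).ncard ≤ (B ∩ X).ncard + 1 := by
      refine (Set.ncard_le_ncard ?_ (hBX.insert x)).trans (Set.ncard_insert_le x _)
      rintro e ⟨heB, rfl | heX⟩
      · exact Set.mem_insert _ _
      · exact Set.mem_insert_of_mem _ ⟨heB, heX⟩
    exact ⟨B, hBK, h1, h2, h3, h4, by omega, by omega⟩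

/-- Each part has discrepancy 2|B ∩ X| - |X| in {-1, 0, 1}. The sum is too large only if both are 1
or both -1; complementing the choice in K₂ changes one sign, and they cancel. -/
lemma IsEquitableOn.union (hK₁ : M.IsRkSeparator K₁) (h₁ : M.IsEquitableOn K₁)
    (h₂ : M.IsEquitableOn K₂) (hK₂ : K₂ ⊆ M.E \ K₁)
    (hr : M.rkNat (K₁ ∪ K₂) = M.rkNat K₁ + M.rkNat K₂) : M.IsEquitableOn (K₁ ∪ K₂) := by
  have hfin₁ := finite_of_subset_ground hK₁.1
  have hfin₂ := finite_of_subset_ground (hK₂.trans Set.sdiff_subset)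
  have hd : ∀ e ∈ K₁, e ∉ K₂ := fun e h h' => (hK₂ h').2 h
  intro X hX
  have hXfin := (hfin₁.union hfin₂).subset hX
  have glue : ∀ B ⊆ K₁, ∀ C ⊆ K₂, M.Indep B → M.Indep (K₁ \ B) → M.Indep C → M.Indep (K₂ \ C) →
      B.ncard = M.rkNat K₁ → (K₁ \ B).ncard = M.rkNat K₁ → C.ncard = M.rkNat K₂ →
      (K₂ \ C).ncard = M.rkNat K₂ →
      X.ncard ≤ 2 * ((B ∩ (X ∩ K₁)).ncard + (C ∩ (X ∩ K₂)).ncard) + 1 →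
      2 * ((B ∩ (X ∩ K₁)).ncard + (C ∩ (X ∩ K₂)).ncard) ≤ X.ncard + 1 →
      ∃ B ⊆ K₁ ∪ K₂, M.Indep B ∧ M.Indep ((K₁ ∪ K₂) \ B) ∧ B.ncard = M.rkNat (K₁ ∪ K₂) ∧
        ((K₁ ∪ K₂) \ B).ncard = M.rkNat (K₁ ∪ K₂) ∧ X.ncard ≤ 2 * (B ∩ X).ncard + 1 ∧
        2 * (B ∩ X).ncard ≤ X.ncard + 1 := by
    intro B hB C hC i1 i2 i3 i4 n1 n2 n3 n4 l1 l2
    have e1 : (K₁ ∪ K₂) \ (B ∪ C) = (K₁ \ B) ∪ (K₂ \ C) := by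
      ext e
      have a1 := hd e
      have a2 : e ∈ B → e ∈ K₁ := @hB e
      have a3 : e ∈ C → e ∈ K₂ := @hC e
      simp only [Set.mem_union, Set.mem_sdiff]
      clear * - a1 a2 a3
      tauto
    have e2 : (B ∪ C) ∩ X = B ∩ (X ∩ K₁) ∪ C ∩ (X ∩ K₂) := by
      ext e
      have a2 : e ∈ B → e ∈ K₁ := @hB e
      have a3 : e ∈ C → e ∈ K₂ := @hC e
      simp only [Set.mem_union, Set.mem_inter_iff]
      clear * - a2 a3
      tauto
    have disj : ∀ S ⊆ K₁, ∀ T ⊆ K₂, Disjoint S T := fun S hS T hT =>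
      Set.disjoint_left.2 fun e h h' => hd e (hS h) (hT h')
    have m1 : (B ∪ C).ncard = M.rkNat (K₁ ∪ K₂) := by
      rw [Set.ncard_union_eq (disj B hB C hC) (hfin₁.subset hB) (hfin₂.subset hC), n1, n3, hr]
    have m2 : ((K₁ ∪ K₂) \ (B ∪ C)).ncard = M.rkNat (K₁ ∪ K₂) := by
      rw [e1, Set.ncard_union_eq (disj _ Set.sdiff_subset _ Set.sdiff_subset)
        (hfin₁.subset Set.sdiff_subset) (hfin₂.subset Set.sdiff_subset), n2, n4, hr]
    have m3 : ((B ∪ C) ∩ X).ncard = (B ∩ (X ∩ K₁)).ncard + (C ∩ (X ∩ K₂)).ncard := by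
      rw [e2, Set.ncard_union_eq (disj _ (Set.inter_subset_left.trans hB) _
        (Set.inter_subset_left.trans hC)) ((hfin₁.subset hB).subset Set.inter_subset_left)
        ((hfin₂.subset hC).subset Set.inter_subset_left)]
    refine ⟨B ∪ C, Set.union_subset_union hB hC, hK₁.indep_union i1 hB i3 (hC.trans hK₂), ?_, m1,
      m2, by rw [m3]; exact l1, by rw [m3]; exact l2⟩
    rw [e1]
    exact hK₁.indep_union i2 Set.sdiff_subset i4 (Set.sdiff_subset.trans hK₂)
  obtain ⟨B, hB, i1, i2, n1, n2, l1, l1'⟩ := h₁ (X ∩ K₁) Set.inter_subset_right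
  obtain ⟨C, hC, i3, i4, n3, n4, l2, l2'⟩ := h₂ (X ∩ K₂) Set.inter_subset_right
  have hXc : (X ∩ K₁).ncard + (X ∩ K₂).ncard = X.ncard := by
    have := ncard_inter_add hXfin (Set.subset_union_left (s := K₁) (t := K₂))
    have e : (K₁ ∪ K₂) \ K₁ = K₂ := by
      ext e
      have := hd e
      simp only [Set.mem_union, Set.mem_sdiff]
      tauto
    rwa [e, Set.inter_eq_left.2 hX] at this
  by_cases hgood : X.ncard ≤ 2 * ((B ∩ (X ∩ K₁)).ncard + (C ∩ (X ∩ K₂)).ncard) + 1 ∧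
      2 * ((B ∩ (X ∩ K₁)).ncard + (C ∩ (X ∩ K₂)).ncard) ≤ X.ncard + 1
  · exact glue B hB C hC i1 i2 i3 i4 n1 n2 n3 n4 hgood.1 hgood.2
  · have hswap : ((K₂ \ C) ∩ (X ∩ K₂)).ncard + (C ∩ (X ∩ K₂)).ncard = (X ∩ K₂).ncard := by
      have := ncard_inter_add (hXfin.subset (Set.inter_subset_left (t := K₂))) hC
      rw [Set.inter_eq_left.2 (Set.inter_subset_right : X ∩ K₂ ⊆ K₂), Set.inter_comm (X ∩ K₂) C,
        Set.inter_comm (X ∩ K₂) (K₂ \ C)] at this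
      omega
    refine glue B hB (K₂ \ C) Set.sdiff_subset i1 i2 i4 ?_ n1 n2 n4 ?_ (by omega) (by omega)
    · rw [Set.sdiff_sdiff_cancel_left hC]; exact i3
    · rw [Set.sdiff_sdiff_cancel_left hC]; exact n3

lemma IsRkSeparator.of_subset (hK : M.IsRkSeparator K) (hX : X ⊆ K)
    (h : M.rkNat X + M.rkNat (K \ X) = M.rkNat K) : M.IsRkSeparator X := by
  refine ⟨hX.trans hK.1, le_antisymm ?_ (M.rkNat_le_add_sdiff (hX.trans hK.1))⟩
  have h1 := M.rkNat_inter_add_rkNat_union_le (K \ X) (M.E \ K)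
  have e : K \ X ∪ M.E \ K = M.E \ X := by
    ext e
    have a1 : e ∈ X → e ∈ K := @hX e
    have a2 : e ∈ K → e ∈ M.E := @hK.1 e
    simp only [Set.mem_union, Set.mem_sdiff]
    clear * - a1 a2
    tauto
  rw [e] at h1
  have := hK.2
  omega

/-- A disconnected separator is cut into two smaller ones; both are separators of the whole matroid,
so the base partition serves for each. -/
lemma IsSplit.isEquitableOn (hM : M.IsSplit) (hP : M.IsBasePartition B₁ B₂)
    (hK : M.IsRkSeparator K) : M.IsEquitableOn K := by
  induction hn : K.ncard using Nat.strong_induction_on generalizing K with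
  | _ n ih =>
  by_cases hKc : M.IsMinorConnected ∅ K
  · exact hM.isEquitableOn_of_isMinorConnected hP hK hKc
  rw [isMinorConnected_empty] at hKc
  push Not at hKc
  obtain ⟨A, hA, hr, hA0, hAK⟩ := hKc
  have hKfin := finite_of_subset_ground hK.1
  have hAfin := hKfin.subset hA
  have hcard := Set.ncard_sdiff_add_ncard_of_subset hA hKfin
  have hlt : A.ncard < K.ncard := Set.ncard_lt_ncard (hA.ssubset_of_ne hAK) hKfin
  have hpos : 0 < A.ncard :=
    (Set.ncard_pos hAfin).2 hA0
  have hAs := hK.of_subset hA hr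
  have hAs' := hK.of_subset (Set.sdiff_subset (t := A)) (by
    rw [Set.sdiff_sdiff_cancel_left hA, add_comm, hr])
  have := IsEquitableOn.union hAs (ih _ (by omega) hAs rfl) (ih _ (by omega) hAs' rfl)
    (Set.sdiff_subset_sdiff_left hK.1) (by rw [Set.union_sdiff_cancel hA, hr])
  rwa [Set.union_sdiff_cancel hA] at this

end Matroid

theorem corollary3p5 {α : Type*} (M : Matroid α) [M.Finite] (hM : M.IsSplit)
    (hpart : ∃ B₁ B₂, M.IsBase B₁ ∧ M.IsBase B₂ ∧ Disjoint B₁ B₂ ∧ B₁ ∪ B₂ = M.E) :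
    M.IsEquitable := by
  obtain ⟨B₁, B₂, h₁, h₂, hd, hu⟩ := hpart
  have hE : M.IsRkSeparator M.E := ⟨Set.Subset.refl _, by simp [Matroid.rkNat_empty]⟩
  intro X hX
  obtain ⟨B, -, i₁, i₂, n₁, n₂, l₁, l₂⟩ := hM.isEquitableOn ⟨h₁, h₂, hd, hu⟩ hE X hX
  exact ⟨B, i₁.isBase_of_ncard n₁, i₂.isBase_of_ncard n₂, by omega, by omega⟩
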